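/- Let $S=\mathbb Z[A,B]$, let $E: y^2=x^3+Ax+B$ be the generic cubic over $S$, and let $\psi_n$ be its classical division polynomials ($\psi_0=0$, $\psi_1=1$, $\psi_2=2y$, $\psi_3=3x^4+6Ax^2+12Bx-A^2$, $\psi_4=4y(x^6+5Ax^4+20Bx^3-5A^2x^2-4ABx-8B^2-A^3)$, $\psi_{2m+1}=\psi_{m+2}\psi_m^3-\psi_{m-1}\psi_{m+1}^3$, $\psi_2\psi_{2m}=\psi_m(\psi_{m+2}\psi_{m-1}^2-\psi_{m-2}\psi_{m+1}^2)$, $\psi_{-n}=-\psi_n$). Put $\phi_n=x\psi_n^2-\psi_{n+1}\psi_{n-1}$ and $\omega_n=(\psi_{n+2}\psi_{n-1}^2-\psi_{n-2}\psi_{n+1}^2)/(4y)$ in the function field of $E$; modulo the equation of $E$, $\phi_n$ and $\psi_n^2$ are polynomials in $x$ alone. For $n\ge 1$ let $J_n(X,Z)$ be the Jacobian matrix (with respect to $X,Z$) of the map $$[n]:\mathbb A^2\to\mathbb A^2,\qquad (X,Z)\mapsto\left(Z^{n^2}\phi_n(X/Z),\ Z^{n^2}\psi_n^2(X/Z)\right).$$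 (1) For every $n\ge1$ the function $\psi_{2n}/\psi_2=2\psi_n\omega_n/\psi_2$ on $E$ is a polynomial in $x$ with coefficients in $S$, and $$\det J_n(X,Z)=n^3Z^{2(n^2-1)}\,\frac{\psi_{2n}}{\psi_2}(X/Z)=2n^3Z^{2(n^2-1)}\,\frac{\psi_n\omega_n}{\psi_2}(X/Z).$$ In particular, elliptic divisibility sequences arise, up to the factor $n^3$, as determinant sequences, in the following sense. Let $K$ be a field of characteristic $0$. (2) Let $a,b\in K$, and let $Q=(x_1,y_1)$ and $P=(x_2,y_2)$ be non-singular affine $K$-points of $y^2=x^3+ax+b$ with $2Q=P$. Then for all $n\ge1$ and $t\in K$, specialising $(A,B)$ to $(a,b)$, $$\det J_n(x_1t,t)=n^3\,(2y_1t^2)^{n^2-1}\,\psi_n(P).$$ (3) Suppose that $K$ is algebraically closed. For all $a,b\in K$ and every non-singular affine point $P$ of $y^2=x^3+ax+b$ over $K$ there are a non-singular affine point $Q=(x_1,y_1)$ with $2Q=P$ and a $t\in K^\times$ such that, specialising $(A,B)$ to $(a,b)$, $\det J_n(x_1t,t)=n^3\psi_n(P)$ for all $n\ge1$. (4) Suppose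 that $K$ is algebraically closed. Let $(h_n)_{n\in\mathbb Z}$ be a sequence in $K$ with $$h_{p+q}h_{p-q}h_r^2-h_{p+r}h_{p-r}h_q^2+h_{q+r}h_{q-r}h_p^2=0\quad\text{for all }p,q,r\in\mathbb Z,$$ $h_1=1$ and $h_2h_3\neq0$ (for instance any elliptic divisibility sequence of integers with $h_1=1$ and $h_2h_3\ne0$). Then there are $a,b,s\in K$ and $t\in K^\times$ such that, specialising $(A,B)$ to $(a,b)$, $\det J_n(s,t)=n^3h_n$ for all $n\ge1$. -/

import Mathlib

universe u

noncomputable section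

namespace EllipticJacobian

/-- The Jacobian matrix `(∂ fᵢ / ∂ xⱼ)` of the endomorphism of affine `d`-space over `R` given by the
polynomials `f₀, …, f_{d-1}`. -/
def jacobianMatrix {R : Type*} [CommRing R] {d : ℕ} (f : Fin d → MvPolynomial (Fin d) R) :
    Matrix (Fin d) (Fin d) (MvPolynomial (Fin d) R) :=
  Matrix.of fun i j => MvPolynomial.pderiv j (f i)

/-- The cubic curve `y² = x³ + a x + b`. -/
def shortCurve {R : Type*} [CommRing R] (a b : R) : WeierstrassCurve R :=
  ⟨0, 0, 0, a, b⟩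

/-- The base ring `S = ℤ[A, B]`. -/
abbrev BaseRing : Type := MvPolynomial (Fin 2) ℤ

/-- The generic curve `y² = x³ + A x + B` over `S = ℤ[A, B]`. -/
abbrev E : WeierstrassCurve BaseRing :=
  shortCurve (MvPolynomial.X 0) (MvPolynomial.X 1)

/-- The function field of the generic curve. -/
abbrev FunField : Type := E.toAffine.FunctionField

/-- The function on the generic curve that a polynomial in `x` and `y` defines. -/
def toFun (p : Polynomial (Polynomial BaseRing)) : FunField :=
  algebraMap E.toAffine.CoordinateRing FunField (WeierstrassCurve.Affine.CoordinateRing.mk E p)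

/-- A polynomial in `x` as a function on the generic curve. -/
def ofX (g : Polynomial BaseRing) : FunField := toFun (Polynomial.C g)

/-- The coordinate function `y` on the generic curve. -/
def yFun : FunField := toFun Polynomial.X

/-- The classical division polynomial `ψₙ`, as a function on the generic curve. -/
def psi (n : ℤ) : FunField := toFun (E.ψ n)

/-- The classical `ωₙ`, given by `4 y ωₙ = ψₙ₊₂ ψₙ₋₁² - ψₙ₋₂ ψₙ₊₁²`, as a function on the generic
curve. -/
def omega (n : ℤ) : FunField :=
  (psi (n + 2) * psi (n - 1) ^ 2 - psi (n - 2) * psi (n + 1) ^ 2) / (4 * yFun)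

/-- The map `[n] : (X, Z) ↦ (Z^(n²) φₙ(X/Z), Z^(n²) ψₙ²(X/Z))` of affine 2-space over `ℤ[A, B]`.
Here `φₙ` and `ψₙ²` are written as polynomials in `x` by means of the equation of the curve, and
`p.homogenize N` is `Z^N p(X/Z)`, with `X` the variable of index `0` and `Z` that of index `1`. -/
def mulMap (n : ℕ) : Fin 2 → MvPolynomial (Fin 2) BaseRing :=
  ![(E.Φ n).homogenize (n ^ 2), (E.ΨSq n).homogenize (n ^ 2)]

/-- The matrix elliptic divisibility sequence `Jₙ(X, Z)`: the Jacobian matrices of the `[n]`. -/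
def J (n : ℕ) : Matrix (Fin 2) (Fin 2) (MvPolynomial (Fin 2) BaseRing) :=
  jacobianMatrix (mulMap n)

/-- The field of fractions of `ℤ[A, B][X, Z]`. -/
abbrev FieldXZ : Type := FractionRing (MvPolynomial (Fin 2) BaseRing)

/-- The variable `X` in the field of fractions of `ℤ[A, B][X, Z]`. -/
def varX : FieldXZ := algebraMap (MvPolynomial (Fin 2) BaseRing) FieldXZ (MvPolynomial.X 0)

/-- The variable `Z` in the field of fractions of `ℤ[A, B][X, Z]`. -/
def varZ : FieldXZ := algebraMap (MvPolynomial (Fin 2) BaseRing) FieldXZ (MvPolynomial.X 1)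

/-- The value of `g ∈ ℤ[A, B][x]` at `x = X/Z`. -/
def atXdivZ (g : Polynomial BaseRing) : FieldXZ :=
  g.eval₂ ((algebraMap (MvPolynomial (Fin 2) BaseRing) FieldXZ).comp MvPolynomial.C) (varX / varZ)

/-- The value of `det Jₙ` at the point `(X, Z) = (s, t)`, for the parameters `(A, B) = (a, b)`. -/
def detJAt {K : Type*} [CommRing K] (a b s t : K) (n : ℕ) : K :=
  MvPolynomial.eval₂ (MvPolynomial.eval₂Hom (Int.castRingHom K) ![a, b]) ![s, t] (J n).det

/-- The value `ψₙ(x, y)` of the `n`-th division polynomial of `y² = x³ + a x + b`. -/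
def psiAt {K : Type*} [CommRing K] (a b x y : K) (n : ℤ) : K :=
  ((shortCurve a b).ψ n).evalEval x y

end EllipticJacobian

end

/-!
The determinant comes down to three facts about `y² = x³ + a x + b`, which are all deduced from the
addition law on affine points.

*Multiples.* If no `ψₙ` vanishes at `P`, as for the generic point, then `n P` is the affine point
with `x`-coordinate `φₙ / ψₙ²` and `y`-coordinate `ψ₂ₙ / 2 ψₙ⁴` (`IsDivSeq.isAt_nsmul`). This is a
strong induction: `x(P ± Q)` are the roots of a quadratic whose coefficients depend on `x(P)` and
`x(Q)` only (`symForm_eq_mul`), and they differ by `4 y(P) y(Q) / (x(P) - x(Q))²` (`sub_mul_eq`);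
this gives `(2 n + 1) P` and `2 n P`, and gives `y(n P)` from `x((n - 1) P)` and `x((n + 1) P)`.
The quadratic comes from a form that is symmetric in all its three arguments, and this symmetry is
the induction step of Ward's formula `ψₘ₊ₙ ψₘ₋ₙ = ψₘ² ψₙ² (x(n P) - x(m P))`
(`IsDivSeq.mul_eq_mulX_sub_mulX`).

*The Wronskian.* The differential `dx / 2y` is invariant, so that its values on a derivation add up
when points are added (`deriv_add`, `deriv_double`). On the function field of the generic curve let
`D` be the derivation with `D A = D B = 0` and `D x = 2 y`. Then `D (x(n P)) = 2 n y(n P)` for the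
generic point `P`, which says that `φₙ' ψₙ² - φₙ (ψₙ²)' = n ψ₂ₙ / ψ₂` as polynomials in `x`
(`wronskian_Φ_ΨSq`). By Euler's identity for homogeneous polynomials, the Jacobian determinant of
`[n]` is `n²` times the homogenised Wronskian (`det_J`), and this is the formula for `det Jₙ`.

*Doubling.* Ward's formula shows that `ψ₂ₙ / ψ₂` satisfies the recursion of a normalised elliptic
divisibility sequence, as does `(2 y)^(n² - 1) ψₙ(2 Q)` at `Q = (x, y)`, which is a sequence of
division polynomials on an isomorphic curve since division polynomials are weighted homogeneous
(`psiAt_scale`). The first terms agree, so `ψ₂ₙ(Q) = ψ₂(Q) (2 y)^(n² - 1) ψₙ(2 Q)`: first for the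
generic point (`psi_two_mul`), then for every point with `y ≠ 0` by specialisation
(`eval₂_preΨ_two_mul`). This proves the formula for `det Jₙ(x₁ t, t)`.

Over an algebraically closed field the slope of the tangent at a half of `P` is a root of a quartic
(`exists_half`), and the scaling is normalised by `2 y₁ t² = 1`. Finally, an elliptic sequence with
`h₁ = 1` and `h₂ ≠ 0` is determined by `h₂`, `h₃`, `h₄`; since also `h₃ ≠ 0`,
`ψᵢ(P) = hᵢ` can be solved for these three, which gives a curve and a point (`exists_psiAt_eq`)
that is nonsingular because `2 y = h₂ ≠ 0`.
-/

noncomputable section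

namespace EllipticJacobian

open Polynomial

/-! ### Normalised elliptic divisibility sequences and division polynomials -/

/-- The recursion of a normalised elliptic divisibility sequence, for a sequence indexed by `ℕ`. -/
structure IsNormRec {R : Type*} [CommRing R] (w : ℕ → R) : Prop where
  zero : w 0 = 0
  one : w 1 = 1
  even (m : ℕ) : w (2 * (m + 2)) * w 2 =
    w (m + 2) * (w (m + 1) ^ 2 * w (m + 4) - w m * w (m + 3) ^ 2)
  odd (m : ℕ) : w (2 * (m + 1) + 1) = w (m + 3) * w (m + 1) ^ 3 - w m * w (m + 2) ^ 3

/-- The recursion determines a sequence from its second, third and fourth terms, if the second one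
is nonzero. -/
theorem IsNormRec.ext {R : Type*} [CommRing R] [IsDomain R] {w v : ℕ → R} (hw : IsNormRec w)
    (hv : IsNormRec v) (h2 : w 2 = v 2) (h3 : w 3 = v 3) (h4 : w 4 = v 4) (h0 : v 2 ≠ 0) :
    w = v := by
  funext n
  induction n using normEDSRec with
  | zero => rw [hw.zero, hv.zero]
  | one => rw [hw.one, hv.one]
  | two => exact h2
  | three => exact h3
  | four => exact h4
  | even m e1 e2 e3 e4 e5 =>
    apply mul_right_cancel₀ h0
    have e := hw.even (m + 1)
    rw [h2] at e
    rw [show 2 * (m + 3) = 2 * (m + 1 + 2) by ring, e, hv.even]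
    simp only [add_assoc, Nat.reduceAdd, e1, e2, e3, e4, e5] at *
  | odd m e1 e2 e3 e4 =>
    rw [show 2 * (m + 2) + 1 = 2 * (m + 1 + 1) + 1 by ring, hw.odd, hv.odd]
    simp only [add_assoc, Nat.reduceAdd, e1, e2, e3, e4] at *

section PsiAt

variable {K : Type*} [CommRing K] (a b x y : K)

theorem psiAt_eq_normEDS (n : ℤ) : psiAt a b x y n =
    normEDS (2 * y) (3 * x ^ 4 + 6 * a * x ^ 2 + 12 * b * x - a ^ 2)
      (2 * x ^ 6 + 10 * a * x ^ 4 + 40 * b * x ^ 3 - 10 * a ^ 2 * x ^ 2 - 8 * a * b * x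
        - 16 * b ^ 2 - 2 * a ^ 3) n := by
  rw [psiAt, WeierstrassCurve.ψ, ← coe_evalEvalRingHom, map_normEDS]
  congr 1
  · simp [WeierstrassCurve.ψ₂, WeierstrassCurve.Affine.polynomialY, shortCurve]
  · simp [WeierstrassCurve.Ψ₃, shortCurve, WeierstrassCurve.b₂, WeierstrassCurve.b₄,
      WeierstrassCurve.b₆, WeierstrassCurve.b₈]
    ring
  · simp [WeierstrassCurve.preΨ₄, shortCurve, WeierstrassCurve.b₂, WeierstrassCurve.b₄,
      WeierstrassCurve.b₆, WeierstrassCurve.b₈]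
    ring

theorem psiAt_two : psiAt a b x y 2 = 2 * y := by
  rw [psiAt_eq_normEDS, normEDS_two]

theorem psiAt_three :
    psiAt a b x y 3 = 3 * x ^ 4 + 6 * a * x ^ 2 + 12 * b * x - a ^ 2 := by
  rw [psiAt_eq_normEDS, normEDS_three]

theorem psiAt_four : psiAt a b x y 4 =
    (2 * x ^ 6 + 10 * a * x ^ 4 + 40 * b * x ^ 3 - 10 * a ^ 2 * x ^ 2 - 8 * a * b * x
        - 16 * b ^ 2 - 2 * a ^ 3) * (2 * y) := by
  rw [psiAt_eq_normEDS, normEDS_four]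

theorem isNormRec_psiAt : IsNormRec fun n : ℕ => psiAt a b x y n where
  zero := by simp [psiAt]
  one := by simp [psiAt]
  even m := by
    have h := normEDS_even (2 * y) (3 * x ^ 4 + 6 * a * x ^ 2 + 12 * b * x - a ^ 2)
      (2 * x ^ 6 + 10 * a * x ^ 4 + 40 * b * x ^ 3 - 10 * a ^ 2 * x ^ 2 - 8 * a * b * x
        - 16 * b ^ 2 - 2 * a ^ 3) (m + 2)
    simp only [psiAt_eq_normEDS]
    push_cast
    rw [normEDS_two, h, show (m : ℤ) + 2 - 1 = m + 1 by ring, show (m : ℤ) + 2 - 2 = m by ring,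
      show (m : ℤ) + 2 + 2 = m + 4 by ring, show (m : ℤ) + 2 + 1 = m + 3 by ring]
    ring
  odd m := by
    simp only [psiAt_eq_normEDS]
    push_cast
    rw [normEDS_odd, show (m : ℤ) + 1 - 1 = m by ring, show (m : ℤ) + 1 + 2 = m + 3 by ring,
      show (m : ℤ) + 1 + 1 = m + 2 by ring]

end PsiAt

/-! ### The addition law on a short cubic -/

section Group

variable {F : Type*} [Field F] {a b : F}

/-- The point `P` of `y² = x³ + a x + b` is affine, with coordinates `(x, y)`. -/
def IsAt (P : (shortCurve a b).toAffine.Point) (x y : F) : Prop :=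
  ∃ h : (shortCurve a b).toAffine.Nonsingular x y, P = .some x y h

variable {P Q : (shortCurve a b).toAffine.Point} {x y u v p q s t d e : F}

theorem equation_shortCurve {K : Type*} [CommRing K] {a b x y : K} :
    (shortCurve a b).toAffine.Equation x y ↔ y ^ 2 = x ^ 3 + a * x + b := by
  rw [WeierstrassCurve.Affine.equation_iff]
  simp [shortCurve]

theorem nonsingular_shortCurve {F : Type*} [Field F] {a b x y : F} (h : y ^ 2 = x ^ 3 + a * x + b)
    (hy : 2 * y ≠ 0) : (shortCurve a b).toAffine.Nonsingular x y := by
  rw [WeierstrassCurve.Affine.nonsingular_iff, equation_shortCurve]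
  refine ⟨h, Or.inr ?_⟩
  simpa only [shortCurve, zero_mul, sub_zero, Ne, eq_neg_iff_add_eq_zero, ← two_mul] using hy

theorem IsAt.equation (h : IsAt P x y) : y ^ 2 = x ^ 3 + a * x + b :=
  equation_shortCurve.1 h.1.1

theorem IsAt.unique (h : IsAt P x y) (h' : IsAt P u v) : x = u ∧ y = v := by
  obtain ⟨_, rfl⟩ := h
  obtain ⟨_, h'⟩ := h'
  simpa using h'

theorem IsAt.neg (h : IsAt P x y) : IsAt (-P) x (-y) := by
  obtain ⟨h, rfl⟩ := h
  have e : (shortCurve a b).toAffine.negY x y = -y := by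
    simp [WeierstrassCurve.Affine.negY, shortCurve]
  refine ⟨e ▸ (WeierstrassCurve.Affine.nonsingular_neg x y).2 h, ?_⟩
  rw [WeierstrassCurve.Affine.Point.neg_some]
  simp only [e]

/-- The form with `(u - v)² (z - x(P + Q)) (z - x(P - Q)) = symForm a b u v z` for points `P`, `Q`
with `x`-coordinates `u`, `v`. What makes it useful is that it is symmetric in `u`, `v` and `z`. -/
def symForm (a b u v z : F) : F :=
  (u - v) ^ 2 * z ^ 2 - 2 * ((u + v) * (u * v + a) + 2 * b) * z + (u * v - a) ^ 2
    - 4 * b * (u + v)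

theorem symForm_swap (a b u v z : F) : symForm a b u v z = symForm a b u z v := by
  unfold symForm; ring

theorem symForm_rotate (a b u v z : F) : symForm a b u v z = symForm a b v z u := by
  unfold symForm; ring

variable [DecidableEq F]

theorem IsAt.add (hP : IsAt P u p) (hQ : IsAt Q v q) (huv : u ≠ v) :
    IsAt (P + Q) (((p - q) / (u - v)) ^ 2 - u - v)
      (-((p - q) / (u - v) * (((p - q) / (u - v)) ^ 2 - u - v - u) + p)) := by
  obtain ⟨hP, rfl⟩ := hP
  obtain ⟨hQ, rfl⟩ := hQ
  have e := WeierstrassCurve.Affine.Point.add_of_X_ne (h₁ := hP) (h₂ := hQ) huv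
  have e1 : (shortCurve a b).toAffine.addX u v ((shortCurve a b).toAffine.slope u v p q) =
      ((p - q) / (u - v)) ^ 2 - u - v := by
    rw [WeierstrassCurve.Affine.slope_of_X_ne huv]
    simp [WeierstrassCurve.Affine.addX, shortCurve]
  have e2 : (shortCurve a b).toAffine.addY u v p ((shortCurve a b).toAffine.slope u v p q) =
      -((p - q) / (u - v) * (((p - q) / (u - v)) ^ 2 - u - v - u) + p) := by
    rw [WeierstrassCurve.Affine.addY, WeierstrassCurve.Affine.negAddY, e1,
      WeierstrassCurve.Affine.slope_of_X_ne huv]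
    simp [WeierstrassCurve.Affine.negY, shortCurve]
  rw [e]
  simp only [e1, e2]
  exact ⟨_, rfl⟩

theorem IsAt.double (hP : IsAt P u p) (h0 : 2 * p ≠ 0) :
    IsAt (P + P) (((3 * u ^ 2 + a) / (2 * p)) ^ 2 - u - u)
      (-((3 * u ^ 2 + a) / (2 * p) * (((3 * u ^ 2 + a) / (2 * p)) ^ 2 - u - u - u) + p)) := by
  obtain ⟨hP, rfl⟩ := hP
  have e0 : (shortCurve a b).toAffine.negY u p = -p := by
    simp [WeierstrassCurve.Affine.negY, shortCurve]
  have hp : p ≠ (shortCurve a b).toAffine.negY u p := by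
    rw [e0]
    exact fun h => h0 (by linear_combination h)
  have e := WeierstrassCurve.Affine.Point.add_self_of_Y_ne (h₁ := hP) hp
  have es : (shortCurve a b).toAffine.slope u u p p = (3 * u ^ 2 + a) / (2 * p) := by
    rw [WeierstrassCurve.Affine.slope_of_Y_ne rfl hp, e0]
    simp [shortCurve, two_mul]
  have e1 : (shortCurve a b).toAffine.addX u u ((shortCurve a b).toAffine.slope u u p p) =
      ((3 * u ^ 2 + a) / (2 * p)) ^ 2 - u - u := by
    rw [es]
    simp [WeierstrassCurve.Affine.addX, shortCurve]
  have e2 : (shortCurve a b).toAffine.addY u u p ((shortCurve a b).toAffine.slope u u p p) =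
      -((3 * u ^ 2 + a) / (2 * p) * (((3 * u ^ 2 + a) / (2 * p)) ^ 2 - u - u - u) + p) := by
    rw [WeierstrassCurve.Affine.addY, WeierstrassCurve.Affine.negAddY, e1, es]
    simp [WeierstrassCurve.Affine.negY, shortCurve]
  rw [e]
  simp only [e1, e2]
  exact ⟨_, rfl⟩

theorem symForm_eq_mul (hP : IsAt P u p) (hQ : IsAt Q v q) (huv : u ≠ v)
    (hs : IsAt (P + Q) s t) (hd : IsAt (P - Q) d e) (z : F) :
    symForm a b u v z = (u - v) ^ 2 * ((z - s) * (z - d)) := by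
  have h0 : u - v ≠ 0 := sub_ne_zero.2 huv
  rw [(hs.unique (hP.add hQ huv)).1, (hd.unique ((sub_eq_add_neg P Q) ▸ hP.add hQ.neg huv)).1]
  have e1 := hP.equation
  have e2 := hQ.equation
  have hb : b = q ^ 2 - v ^ 3 - a * v := by linear_combination -e2
  have ha : a * (u - v) = p ^ 2 - q ^ 2 - u ^ 3 + v ^ 3 := by linear_combination e2 - e1
  have ha' : a = (p ^ 2 - q ^ 2 - u ^ 3 + v ^ 3) / (u - v) := by rw [← ha]; field_simp
  rw [symForm, hb, ha']
  field_simp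
  ring

/-- Here `d = x(P - Q)` and `s = x(P + Q)`. -/
theorem sub_mul_eq (hP : IsAt P u p) (hQ : IsAt Q v q) (huv : u ≠ v)
    (hs : IsAt (P + Q) s t) (hd : IsAt (P - Q) d e) :
    (u - v) ^ 2 * (d - s) = 4 * p * q := by
  have h0 : u - v ≠ 0 := sub_ne_zero.2 huv
  rw [(hs.unique (hP.add hQ huv)).1, (hd.unique ((sub_eq_add_neg P Q) ▸ hP.add hQ.neg huv)).1]
  field_simp
  ring

/-- The case `P = Q` of `symForm_eq_mul`, in which `P - Q` is not affine and the form has degree one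
in `z`. -/
theorem symForm_self (hP : IsAt P u p) (h0 : 2 * p ≠ 0) (hs : IsAt (P + P) s t) (z : F) :
    symForm a b u u z = (2 * p) ^ 2 * (s - z) := by
  rw [(hs.unique (hP.double h0)).1, mul_sub, mul_sub, mul_sub, ← mul_pow, mul_div_cancel₀ _ h0]
  unfold symForm
  linear_combination (4 * z + 8 * u) * hP.equation

end Group

/-! ### The multiples of a point -/

section Multiples

variable {F : Type*} [Field F] {a b : F}

/-- `w` is the sequence of values at the affine point `P = (x, y)` of the division polynomials of
`y² = x³ + a x + b`, and none of them vanishes, so that `P` has infinite order. -/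
structure IsDivSeq (P : (shortCurve a b).toAffine.Point) (x y : F) (w : ℕ → F) : Prop
    extends IsNormRec w where
  isAt : IsAt P x y
  two : w 2 = 2 * y
  three : w 3 = 3 * x ^ 4 + 6 * a * x ^ 2 + 12 * b * x - a ^ 2
  four : w 4 = (2 * x ^ 6 + 10 * a * x ^ 4 + 40 * b * x ^ 3 - 10 * a ^ 2 * x ^ 2 - 8 * a * b * x
        - 16 * b ^ 2 - 2 * a ^ 3) * (2 * y)
  ne_zero (n : ℕ) : w (n + 1) ≠ 0

/-- The expression `x - ψₙ₊₁ ψₙ₋₁ / ψₙ²` for the `x`-coordinate of `n P`, with `n = k + 1`. -/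
def mulX (x : F) (w : ℕ → F) (k : ℕ) : F := x - w (k + 2) * w k / w (k + 1) ^ 2

/-- The expression `ψ₂ₙ / (2 ψₙ⁴)` for the `y`-coordinate of `n P`, with `n = k + 1`. -/
def mulY (w : ℕ → F) (k : ℕ) : F := w (2 * (k + 1)) / (2 * w (k + 1) ^ 4)

variable {P : (shortCurve a b).toAffine.Point} {x y : F} {w : ℕ → F}

namespace IsDivSeq

theorem two_y_ne_zero (hw : IsDivSeq P x y w) : 2 * y ≠ 0 := hw.two ▸ hw.ne_zero 1

theorem two_ne_zero (hw : IsDivSeq P x y w) : (2 : F) ≠ 0 := left_ne_zero_of_mul hw.two_y_ne_zero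

theorem y_ne_zero (hw : IsDivSeq P x y w) : y ≠ 0 := right_ne_zero_of_mul hw.two_y_ne_zero

theorem mulX_zero (hw : IsDivSeq P x y w) : mulX x w 0 = x := by
  simp [mulX, hw.zero]

theorem mulX_sub_mulX_succ (hw : IsDivSeq P x y w) (k : ℕ) :
    mulX x w k - mulX x w (k + 1) = w (2 * (k + 1) + 1) / (w (k + 1) ^ 2 * w (k + 2) ^ 2) := by
  have h1 := hw.ne_zero k
  have h2 := hw.ne_zero (k + 1)
  rw [hw.odd, mulX, mulX]
  field_simp
  ring

theorem mulX_succ_ne (hw : IsDivSeq P x y w) (k : ℕ) : mulX x w (k + 1) ≠ x := by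
  have h1 := hw.ne_zero k
  have h2 := hw.ne_zero (k + 1)
  have h3 := hw.ne_zero (k + 2)
  rw [mulX]
  intro h
  have : w (k + 1 + 2) * w (k + 1) / w (k + 1 + 1) ^ 2 = 0 := by linear_combination -h
  simp_all

theorem two_mul_mulY (hw : IsDivSeq P x y w) (k : ℕ) :
    2 * mulY w k = w (2 * (k + 1)) / w (k + 1) ^ 4 := by
  have := hw.two_ne_zero
  rw [mulY]
  field_simp

theorem two_mul_mulY_ne_zero (hw : IsDivSeq P x y w) (k : ℕ) : 2 * mulY w k ≠ 0 := by
  have n1 := hw.ne_zero k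
  have n2 := hw.ne_zero (2 * k + 1)
  rw [hw.two_mul_mulY, mul_add]
  positivity

variable [DecidableEq F]

/-- The doubled point has the expected coordinates, which starts the induction. -/
theorem isAt_two (hw : IsDivSeq P x y w) : IsAt (2 • P) (mulX x w 1) (mulY w 1) := by
  have h0 := hw.two_y_ne_zero
  have h1 := hw.two_ne_zero
  have h2 := hw.y_ne_zero
  have e := hw.isAt.equation
  have hb : b = y ^ 2 - x ^ 3 - a * x := by linear_combination -e
  rw [two_nsmul]
  convert hw.isAt.double h0 using 1
  · rw [mulX]
    simp only [Nat.reduceAdd]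
    rw [hw.two, hw.three, hw.one, hb]
    field_simp
    ring
  · rw [mulY]
    simp only [Nat.reduceAdd, Nat.reduceMul]
    rw [hw.two, hw.four, hb]
    field_simp
    ring

/-- The `y`-coordinate of `n P` follows from the `x`-coordinates of `(n - 1) P`, `n P`,
`(n + 1) P`. -/
theorem eq_mulY (hw : IsDivSeq P x y w) {k : ℕ} {s t u : F}
    (h1 : IsAt ((k + 1) • P) (mulX x w k) s)
    (h2 : IsAt ((k + 2) • P) (mulX x w (k + 1)) t)
    (h3 : IsAt ((k + 3) • P) (mulX x w (k + 2)) u) : t = mulY w (k + 1) := by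
  have e := sub_mul_eq h2 hw.isAt (hw.mulX_succ_ne k) (s := mulX x w (k + 2)) (t := u)
    (by rwa [← succ_nsmul]) (d := mulX x w k) (e := s)
    (by rwa [show (k + 2) • P = (k + 1) • P + P from succ_nsmul P (k + 1), add_sub_cancel_right])
  have n1 := hw.ne_zero k
  have n2 := hw.ne_zero (k + 1)
  have n3 := hw.ne_zero (k + 2)
  have n0 := hw.y_ne_zero
  have n4 := hw.two_ne_zero
  have ev := hw.even k
  rw [hw.two] at ev
  have ev' : w (2 * (k + 2)) =
      w (k + 2) * (w (k + 1) ^ 2 * w (k + 4) - w k * w (k + 3) ^ 2) / (2 * y) := by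
    rw [← ev]; field_simp
  have n5 : 4 * y ≠ 0 := by
    rw [show (4 : F) * y = 2 * (2 * y) by ring]; positivity
  have et : t = (mulX x w (k + 1) - x) ^ 2 * (mulX x w k - mulX x w (k + 2)) / (4 * y) := by
    rw [e, mul_right_comm, mul_div_cancel_left₀ _ n5]
  rw [et, mulY, mulX, mulX, mulX, show k + 1 + 1 = k + 2 from rfl, ev',
    show (4 : F) = 2 * 2 by norm_num]
  simp only [add_assoc, Nat.reduceAdd] at *
  field_simp
  ring

/-- With `n = k + 1`, the difference of `(n + 1) P` and `n P` is `P`, so that `sub_mul_eq` gives the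
`x`-coordinate of their sum. -/
theorem isAt_odd (hw : IsDivSeq P x y w) {k : ℕ}
    (h1 : IsAt ((k + 1) • P) (mulX x w k) (mulY w k))
    (h2 : IsAt ((k + 2) • P) (mulX x w (k + 1)) (mulY w (k + 1))) :
    ∃ t, IsAt ((2 * k + 3) • P) (mulX x w (2 * k + 2)) t := by
  have n1 := hw.ne_zero k
  have n2 := hw.ne_zero (k + 1)
  have n3 := hw.ne_zero (2 * k + 2)
  have n4 := hw.two_ne_zero
  have e := hw.mulX_sub_mulX_succ k
  have hne : mulX x w (k + 1) ≠ mulX x w k := by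
    intro h
    rw [h, sub_self, eq_comm, div_eq_zero_iff] at e
    simp_all [mul_add]
  obtain ⟨s, t, hs⟩ : ∃ s t, IsAt ((k + 2) • P + (k + 1) • P) s t := ⟨_, _, h2.add h1 hne⟩
  have hd : IsAt ((k + 2) • P - (k + 1) • P) x y := by
    rw [show (k + 2) • P = (k + 1) • P + P from succ_nsmul P (k + 1), add_sub_cancel_left]
    exact hw.isAt
  have e2 := sub_mul_eq h2 h1 hne hs hd
  rw [← add_nsmul, show k + 2 + (k + 1) = 2 * k + 3 by ring] at hs
  suffices h : s = mulX x w (2 * k + 2) from ⟨t, h ▸ hs⟩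
  rw [← neg_sq, neg_sub, e] at e2
  rw [mulX, eq_sub_iff_add_eq, ← eq_sub_iff_add_eq']
  rw [mulY, mulY] at e2
  simp only [mul_add, add_assoc, Nat.reduceAdd, Nat.reduceMul] at *
  field_simp at e2 ⊢
  apply mul_left_cancel₀ (mul_ne_zero n4 n4)
  linear_combination -e2

/-- With `n = k + 2`, the value of `symForm` at `x(n P)`, `x(n P)`, `x(P)` is computed in two ways:
it gives `x(2 n P)` by doubling, and it is known from `x((n - 1) P)` and `x((n + 1) P)`. -/
theorem isAt_even (hw : IsDivSeq P x y w) {k : ℕ} {s u : F}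
    (h1 : IsAt ((k + 1) • P) (mulX x w k) s)
    (h2 : IsAt ((k + 2) • P) (mulX x w (k + 1)) (mulY w (k + 1)))
    (h3 : IsAt ((k + 3) • P) (mulX x w (k + 2)) u) :
    ∃ t, IsAt ((2 * k + 4) • P) (mulX x w (2 * k + 3)) t := by
  have n1 := hw.ne_zero k
  have n2 := hw.ne_zero (k + 1)
  have n3 := hw.ne_zero (k + 2)
  have n4 := hw.two_ne_zero
  have n5 := hw.ne_zero (2 * k + 3)
  have hY : 2 * mulY w (k + 1) = w (2 * k + 4) / w (k + 2) ^ 4 := by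
    rw [mulY]; simp only [mul_add, add_assoc, Nat.reduceAdd, Nat.reduceMul]; field_simp
  have h0 : 2 * mulY w (k + 1) ≠ 0 := by rw [hY]; positivity
  obtain ⟨s', t, hs⟩ : ∃ s t, IsAt ((k + 2) • P + (k + 2) • P) s t := ⟨_, _, h2.double h0⟩
  have e2 := symForm_self h2 h0 hs x
  rw [← add_nsmul, show k + 2 + (k + 2) = 2 * k + 4 by ring] at hs
  have e1 := symForm_eq_mul h2 hw.isAt (hw.mulX_succ_ne k) (s := mulX x w (k + 2)) (t := u)
    (by rwa [← succ_nsmul]) (d := mulX x w k) (e := s)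
    (by rwa [show (k + 2) • P = (k + 1) • P + P from succ_nsmul P (k + 1), add_sub_cancel_right])
    (mulX x w (k + 1))
  rw [symForm_swap, e2, hw.mulX_sub_mulX_succ, ← neg_sub (mulX x w k), hw.mulX_sub_mulX_succ, hY]
    at e1
  suffices h : s' = mulX x w (2 * k + 3) from ⟨t, h ▸ hs⟩
  rw [mulX] at e1
  rw [mulX, eq_sub_iff_add_eq, ← eq_sub_iff_add_eq']
  simp only [mul_add, add_assoc, Nat.reduceAdd, Nat.reduceMul] at *
  field_simp at e1 ⊢
  apply mul_left_cancel₀ (mul_ne_zero (pow_ne_zero 2 n3) (pow_ne_zero 2 n1))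
  linear_combination e1

theorem exists_isAt_mulX (hw : IsDivSeq P x y w) (k : ℕ) :
    ∃ t, IsAt ((k + 1) • P) (mulX x w k) t := by
  induction k using Nat.strong_induction_on with
  | _ k ih =>
    obtain ⟨i, rfl | rfl⟩ := k.even_or_odd'
    · match i with
      | 0 => exact ⟨y, by simpa [hw.mulX_zero] using hw.isAt⟩
      | 1 => exact hw.isAt_odd (k := 0) (by simpa [hw.mulX_zero, mulY, hw.one, hw.two,
          hw.two_ne_zero] using hw.isAt) hw.isAt_two
      | i + 2 =>
        obtain ⟨s, h0⟩ := ih i (by omega)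
        obtain ⟨t, h1⟩ := ih (i + 1) (by omega)
        obtain ⟨u, h2⟩ := ih (i + 2) (by omega)
        obtain ⟨v, h3⟩ := ih (i + 3) (by omega)
        have e1 := hw.eq_mulY h0 h1 h2
        have e2 := hw.eq_mulY h1 h2 h3
        subst e1 e2
        exact hw.isAt_odd h1 h2
    · match i with
      | 0 => exact ⟨_, hw.isAt_two⟩
      | i + 1 =>
        obtain ⟨s, h0⟩ := ih i (by omega)
        obtain ⟨t, h1⟩ := ih (i + 1) (by omega)
        obtain ⟨u, h2⟩ := ih (i + 2) (by omega)
        have e1 := hw.eq_mulY h0 h1 h2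
        subst e1
        exact hw.isAt_even h0 h1 h2

/-- The multiples of `P` have the coordinates that the division polynomials predict. -/
theorem isAt_nsmul (hw : IsDivSeq P x y w) (k : ℕ) :
    IsAt ((k + 1) • P) (mulX x w k) (mulY w k) := by
  cases k with
  | zero => simpa [hw.mulX_zero, mulY, hw.one, hw.two, hw.two_ne_zero] using hw.isAt
  | succ k =>
    obtain ⟨s, h0⟩ := hw.exists_isAt_mulX k
    obtain ⟨t, h1⟩ := hw.exists_isAt_mulX (k + 1)
    obtain ⟨u, h2⟩ := hw.exists_isAt_mulX (k + 2)
    have e := hw.eq_mulY h0 h1 h2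
    subst e
    exact h1

theorem symForm_mulX (hw : IsDivSeq P x y w) (k : ℕ) (z : F) :
    symForm a b (mulX x w (k + 1)) x z =
      (mulX x w (k + 1) - x) ^ 2 * ((z - mulX x w (k + 2)) * (z - mulX x w k)) :=
  symForm_eq_mul (hw.isAt_nsmul (k + 1)) hw.isAt (hw.mulX_succ_ne k)
    (by simpa only [← succ_nsmul] using hw.isAt_nsmul (k + 2))
    (by simpa only [succ_nsmul _ (k + 1), add_sub_cancel_right] using hw.isAt_nsmul k) z

theorem mulX_one_sub (hw : IsDivSeq P x y w) (z : F) :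
    symForm a b x x z = (2 * y) ^ 2 * (mulX x w 1 - z) :=
  symForm_self hw.isAt hw.two_y_ne_zero
    (by simpa only [← two_nsmul] using hw.isAt_two) z

/-- Ward's formula `ψₘ₊ₙ ψₘ₋ₙ = ψₘ² ψₙ² (x(n P) - x(m P))`, with `n = j + 1` and `m = n + k + 1`.
The step from `n - 1` and `n` to `n + 1` is the symmetry of `symForm` at
`x(n P)`, `x(P)`, `x(m P)`. -/
theorem mul_eq_mulX_sub_mulX (hw : IsDivSeq P x y w) (j k : ℕ) :
    w (2 * j + k + 3) * w (k + 1) =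
      w (j + k + 2) ^ 2 * w (j + 1) ^ 2 * (mulX x w j - mulX x w (j + k + 1)) := by
  induction j using Nat.twoStepInduction generalizing k with
  | zero =>
    have n1 := hw.ne_zero (k + 1)
    rw [hw.mulX_zero, mulX]
    simp only [hw.one, mul_zero, zero_add, add_assoc, Nat.reduceAdd] at *
    field_simp
    ring
  | one =>
    have e := hw.symForm_mulX (k + 1) x
    rw [symForm_rotate, hw.mulX_one_sub, ← hw.two] at e
    have n1 := hw.ne_zero k
    have n2 := hw.ne_zero (k + 1)
    have n3 := hw.ne_zero (k + 2)
    have n4 := hw.ne_zero (k + 3)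
    rw [show 1 + k + 1 = k + 1 + 1 by ring, show 1 + 1 = 2 from rfl, mul_assoc, e]
    simp only [mulX, add_assoc, Nat.reduceAdd] at *
    rw [show 2 * 1 + (k + 3) = k + 5 by ring, show 1 + (k + 2) = k + 3 by ring]
    field_simp
    ring
  | more j h1 h2 =>
    have n1 := hw.ne_zero j
    have n2 := hw.ne_zero (j + 1)
    have n3 := hw.ne_zero (j + k + 3)
    have n4 := hw.ne_zero (2 * j + k + 5)
    have n5 := hw.ne_zero (k + 1)
    have n6 := hw.ne_zero (2 * j + k + 4)
    have n7 := hw.ne_zero (k + 2)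
    have h1 : w (2 * j + k + 5) * w (k + 3) =
        w (j + k + 4) ^ 2 * w (j + 1) ^ 2 * (mulX x w j - mulX x w (j + k + 3)) := by
      have := h1 (k + 2)
      ring_nf at this ⊢
      exact this
    have h2 : w (2 * j + k + 6) * w (k + 2) =
        w (j + k + 4) ^ 2 * w (j + 2) ^ 2 * (mulX x w (j + 1) - mulX x w (j + k + 3)) := by
      have := h2 (k + 1)
      ring_nf at this ⊢
      exact this
    have e := hw.symForm_mulX j (mulX x w (j + k + 3))
    rw [show 2 * (j + 2) + k + 3 = 2 * j + k + 7 by ring,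
      show j + 2 + k + 2 = j + k + 4 by ring, show j + 2 + k + 1 = j + k + 3 by ring,
      show j + 2 + 1 = j + 3 by ring]
    generalize hM : mulX x w (j + k + 3) = M at *
    have hD1 : mulX x w (j + 1) - M ≠ 0 := by
      intro h
      rw [h, mul_zero] at h2
      exact mul_ne_zero n4 n5 h2
    have hD0 : mulX x w j - M ≠ 0 := by
      intro h
      rw [h, mul_zero] at h1
      exact mul_ne_zero n6 n7 h1
    have hne : M ≠ mulX x w (j + 1) := fun h => hD1 (by rw [h, sub_self])
    have e' := symForm_eq_mul (hM ▸ hw.isAt_nsmul (j + k + 3)) (hw.isAt_nsmul (j + 1)) hne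
      (s := mulX x w (2 * j + k + 5)) (d := mulX x w (k + 1))
      (by rw [← add_nsmul, show j + k + 3 + 1 + (j + 1 + 1) = 2 * j + k + 5 + 1 by ring]
          exact hw.isAt_nsmul _)
      (by rw [show j + k + 3 + 1 = (k + 1 + 1) + (j + 1 + 1) by ring, add_nsmul,
            add_sub_cancel_right]
          exact hw.isAt_nsmul _) x
    have f1 : mulX x w (j + 1) - x = -(w (j + 3) * w (j + 1) / w (j + 2) ^ 2) := by
      rw [mulX]; ring
    have f2 : x - mulX x w (2 * j + k + 5) =
        w (2 * j + k + 7) * w (2 * j + k + 5) / w (2 * j + k + 6) ^ 2 := by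
      rw [mulX]; ring
    have f3 : x - mulX x w (k + 1) = w (k + 3) * w (k + 1) / w (k + 2) ^ 2 := by
      rw [mulX]; ring
    rw [symForm_rotate, e, f1, f2, f3] at e'
    simp only [add_assoc, Nat.reduceAdd] at *
    field_simp at e'
    -- the two earlier instances and the symmetry, multiplied out and cleared of nonzero factors
    have hc : (mulX x w (j + 1) - M) ^ 2 * (mulX x w j - M) * w (j + k + 4) ^ 2
        * w (j + 1) ^ 2 * w (j + 2) ^ 4 ≠ 0 := by positivity
    apply mul_left_cancel₀ hc
    linear_combination (-(w (2 * j + (k + 7)) * w (k + 1) * (mulX x w (j + 1) - M) ^ 2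
        * w (j + 2) ^ 4)) * h1 - e' + w (j + 3) ^ 2 * w (j + 1) ^ 2 * (mulX x w (j + 2) - M)
        * (mulX x w j - M) * (w (2 * j + (k + 6)) * w (k + 2)
          + w (j + (k + 4)) ^ 2 * w (j + 2) ^ 2 * (mulX x w (j + 1) - M)) * h2

/-- The even relation of the sequence `ψ₂ₙ`: each of its three terms is given by Ward's formula, and
the `x`-coordinates cancel. -/
theorem even_double (hw : IsDivSeq P x y w) (m : ℕ) : w (2 * (2 * (m + 2))) * w 4 * w 2 ^ 2 =
    w (2 * (m + 2)) *
      (w (2 * (m + 1)) ^ 2 * w (2 * (m + 4)) - w (2 * m) * w (2 * (m + 3)) ^ 2) := by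
  cases m with
  | zero => simp only [mul_zero, zero_add, Nat.reduceMul, hw.zero]; ring
  | succ i =>
    have e1 := hw.mul_eq_mulX_sub_mulX (2 * i + 3) 3
    have e2 := hw.mul_eq_mulX_sub_mulX 1 (2 * i + 5)
    have e3 := hw.mul_eq_mulX_sub_mulX 1 (2 * i + 1)
    ring_nf at e1 e2 e3 ⊢
    linear_combination w 2 ^ 2 * e1 - w (4 + i * 2) ^ 2 * e2 + w (8 + i * 2) ^ 2 * e3

/-- The odd relation of the sequence `ψ₂ₙ`. -/
theorem odd_double (hw : IsDivSeq P x y w) (m : ℕ) : w (2 * (2 * (m + 1) + 1)) * w 2 ^ 3 =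
    w (2 * (m + 3)) * w (2 * (m + 1)) ^ 3 - w (2 * m) * w (2 * (m + 2)) ^ 3 := by
  cases m with
  | zero => simp only [mul_zero, zero_add, Nat.reduceMul, Nat.reduceAdd, hw.zero]; ring
  | succ i =>
    have e1 := hw.mul_eq_mulX_sub_mulX (2 * i + 3) 1
    have e2 := hw.mul_eq_mulX_sub_mulX 1 (2 * i + 3)
    have e3 := hw.mul_eq_mulX_sub_mulX 1 (2 * i + 1)
    ring_nf at e1 e2 e3 ⊢
    linear_combination w 2 ^ 2 * e1 - w (4 + i * 2) ^ 2 * e2 + w (6 + i * 2) ^ 2 * e3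

end IsDivSeq

end Multiples

/-! ### The invariant differential -/

section InvariantDifferential

variable {F : Type*} [Field F] {a b : F} {P Q : (shortCurve a b).toAffine.Point}
  {x y u v p q s t c e : F} {w : ℕ → F} {k : Type*} [CommRing k] {_ : Algebra k F}
  (D : Derivation k F F)

/-- A derivation with value `c` of `dx / 2y` maps `y` to `(3 x² + a) c`, by the equation of the
curve. -/
theorem deriv_y (ha : D a = 0) (hb : D b = 0) (hP : IsAt P u p) (h0 : 2 * p ≠ 0)
    (hu : D u = 2 * p * c) : D p = (3 * u ^ 2 + a) * c := by
  have h := congrArg D hP.equation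
  simp only [map_add, Derivation.leibniz, Derivation.leibniz_pow, ha, hb, hu, smul_eq_mul,
    nsmul_eq_mul] at h
  apply mul_left_cancel₀ h0
  push_cast at h
  linear_combination h

variable [DecidableEq F]

/-- Invariance of the differential `dx / 2y` under addition: if it takes the values `c` and `e` on
`D` at `P` and at `Q`, then it takes the value `c + e` at `P + Q`. -/
theorem deriv_add (ha : D a = 0) (hb : D b = 0) (hP : IsAt P u p) (hQ : IsAt Q v q)
    (huv : u ≠ v) (hp : 2 * p ≠ 0) (hq : 2 * q ≠ 0) (hu : D u = 2 * p * c) (hv : D v = 2 * q * e)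
    (hs : IsAt (P + Q) s t) : D s = 2 * t * (c + e) := by
  have h0 : u - v ≠ 0 := sub_ne_zero.2 huv
  obtain ⟨es, et⟩ := hs.unique (hP.add hQ huv)
  -- the slope `l` of the chord is kept as a variable, and `a` and `p` are expressed by it
  generalize hl : (p - q) / (u - v) = l at es et
  rw [div_eq_iff h0] at hl
  have e1 := hP.equation
  have e2 := hQ.equation
  have hDp := deriv_y D ha hb hP hp hu
  have hDq := deriv_y D ha hb hQ hq hv
  have hDl := congrArg D hl
  simp only [map_sub, Derivation.leibniz, smul_eq_mul, hDp, hDq, hu, hv] at hDl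
  have hp' : p = q + l * (u - v) := by linear_combination hl
  have ha' : a = l * (p + q) - (u ^ 2 + u * v + v ^ 2) := by
    apply mul_right_cancel₀ h0
    linear_combination e2 - e1 + (p + q) * hl
  rw [et, ← es, es]
  simp only [map_sub, Derivation.leibniz_pow, smul_eq_mul, nsmul_eq_mul, hu, hv]
  apply mul_right_cancel₀ h0
  rw [ha', hp'] at hDl
  rw [hp']
  push_cast
  linear_combination -2 * l * hDl

/-- Invariance of `dx / 2y` under doubling. -/
theorem deriv_double (ha : D a = 0) (hb : D b = 0) (hP : IsAt P u p) (hp : 2 * p ≠ 0)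
    (hu : D u = 2 * p * c) (hs : IsAt (P + P) s t) : D s = 2 * t * (c + c) := by
  obtain ⟨es, et⟩ := hs.unique (hP.double hp)
  generalize hl : (3 * u ^ 2 + a) / (2 * p) = l at es et
  rw [div_eq_iff hp] at hl
  have hDp := deriv_y D ha hb hP hp hu
  have hDl := congrArg D hl
  have h3 : D 3 = 0 := by exact_mod_cast D.map_natCast 3
  have h2 : D 2 = 0 := by exact_mod_cast D.map_natCast 2
  simp only [map_add, Derivation.leibniz, Derivation.leibniz_pow, smul_eq_mul, nsmul_eq_mul, hDp,
    hu, ha, h2, h3] at hDl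
  push_cast at hDl
  rw [et, ← es, es]
  simp only [map_sub, Derivation.leibniz_pow, smul_eq_mul, nsmul_eq_mul, hu]
  apply mul_right_cancel₀ hp
  push_cast
  linear_combination -2 * l * hDl - 4 * l ^ 2 * c * hl

theorem IsDivSeq.deriv_mulX (hw : IsDivSeq P x y w) (ha : D a = 0) (hb : D b = 0)
    (hx : D x = 2 * y) (k : ℕ) : D (mulX x w k) = 2 * mulY w k * (k + 1) := by
  have hx' : D x = 2 * y * 1 := by rw [hx, mul_one]
  induction k with
  | zero =>
    rw [hw.mulX_zero, hx, mulY]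
    simp [hw.one, hw.two, mul_div_cancel_left₀ y hw.two_ne_zero]
  | succ k ih =>
    cases k with
    | zero =>
      rw [deriv_double D ha hb hw.isAt hw.two_y_ne_zero hx'
        (by simpa only [← two_nsmul] using hw.isAt_two)]
      simp
    | succ k =>
      rw [deriv_add D ha hb (hw.isAt_nsmul (k + 1)) hw.isAt (hw.mulX_succ_ne k)
        (hw.two_mul_mulY_ne_zero (k + 1)) hw.two_y_ne_zero ih hx'
        (by simpa only [← succ_nsmul] using hw.isAt_nsmul (k + 2))]
      push_cast
      ring

theorem IsDivSeq.deriv_num_mul_sub (hw : IsDivSeq P x y w) (ha : D a = 0) (hb : D b = 0)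
    (hx : D x = 2 * y) {k : ℕ} {f g : F} (hg : w (k + 1) ^ 2 = g) (hf : mulX x w k = f / g) :
    D f * g - f * D g = (k + 1) * w (2 * (k + 1)) := by
  have h0 := hw.ne_zero k
  have hg0 : g ≠ 0 := hg ▸ pow_ne_zero 2 h0
  have h := hw.deriv_mulX D ha hb hx k
  rw [hf, Derivation.leibniz_div, hw.two_mul_mulY, show w (k + 1) ^ 4 = g ^ 2 by rw [← hg]; ring,
    smul_eq_mul, smul_eq_mul, smul_eq_mul] at h
  field_simp at h
  linear_combination h

end InvariantDifferential

/-! ### The generic point -/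

section GenericPoint

open WeierstrassCurve WeierstrassCurve.Affine

/-- The coordinate function `x` on the generic curve. -/
def xFun : FunField := ofX X

/-- The constant function `A`. -/
def aFun : FunField := ofX (C (MvPolynomial.X 0))

/-- The constant function `B`. -/
def bFun : FunField := ofX (C (MvPolynomial.X 1))

/-- `toFun` as a ring homomorphism. -/
def toFunHom : Polynomial (Polynomial BaseRing) →+* FunField :=
  (algebraMap E.toAffine.CoordinateRing FunField).comp (CoordinateRing.mk E)

/-- `ofX` as a ring homomorphism. -/
def ofXHom : Polynomial BaseRing →+* FunField := toFunHom.comp C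

theorem toFunHom_apply (p) : toFunHom p = toFun p := rfl

theorem ofXHom_apply (p) : ofXHom p = ofX p := rfl

theorem ofXHom_injective : Function.Injective ofXHom := by
  rw [injective_iff_map_eq_zero]
  intro p hp
  have h : CoordinateRing.mk E (C p) = 0 :=
    IsFractionRing.injective E.toAffine.CoordinateRing FunField (by rw [map_zero]; exact hp)
  have := CoordinateRing.smul_basis_eq_zero (W' := E.toAffine) (p := p) (q := 0)
    (by rw [CoordinateRing.smul, CoordinateRing.smul, h]; simp)
  exact this.1

theorem equation_generic : yFun ^ 2 = xFun ^ 3 + aFun * xFun + bFun := by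
  have h : toFunHom E.toAffine.polynomial = 0 := by
    rw [toFunHom, RingHom.comp_apply, CoordinateRing.mk, AdjoinRoot.mk_self, map_zero]
  simp only [WeierstrassCurve.Affine.polynomial, shortCurve, map_add, map_mul, map_pow, map_zero,
    zero_mul, add_zero] at h
  have h' := sub_eq_zero.1 ((map_sub toFunHom _ _).symm.trans h)
  simpa only [map_add, map_mul, map_pow] using! h'

/-- `ψₙ` as a function on the generic curve is the value of the division polynomial at the generic
point. -/
theorem psi_eq_psiAt (n : ℤ) : psi n = psiAt aFun bFun xFun yFun n := by
  rw [psiAt_eq_normEDS, psi, ← toFunHom_apply, WeierstrassCurve.ψ, map_normEDS]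
  have hA : toFunHom (C (C (MvPolynomial.X 0))) = aFun := rfl
  have hB : toFunHom (C (C (MvPolynomial.X 1))) = bFun := rfl
  have hx : toFunHom (C X) = xFun := rfl
  have hy : toFunHom X = yFun := rfl
  have hn (k : ℕ) [k.AtLeastTwo] : toFunHom (C ofNat(k)) = ofNat(k) := by
    rw [← map_ofNat toFunHom k, C_ofNat]
  have hn' (k : ℕ) [k.AtLeastTwo] : toFunHom (C (C ofNat(k))) = ofNat(k) := by
    rw [C_ofNat, hn]
  congr 1
  · simp [WeierstrassCurve.ψ₂, WeierstrassCurve.Affine.polynomialY, shortCurve, hy, hn']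
  · simp [WeierstrassCurve.Ψ₃, shortCurve, WeierstrassCurve.b₂, WeierstrassCurve.b₄,
      WeierstrassCurve.b₆, WeierstrassCurve.b₈, hA, hB, hx, hn, hn']
    ring
  · simp [WeierstrassCurve.preΨ₄, shortCurve, WeierstrassCurve.b₂, WeierstrassCurve.b₄,
      WeierstrassCurve.b₆, WeierstrassCurve.b₈, hA, hB, hx, hn, hn']
    ring

instance : CharZero FunField :=
  charZero_of_injective_ringHom ofXHom_injective

theorem yFun_ne_zero : yFun ≠ 0 := by
  intro h
  have h1 : toFunHom X = 0 := h
  have h : CoordinateRing.mk E X = 0 :=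
    IsFractionRing.injective E.toAffine.CoordinateRing FunField (by rw [map_zero]; exact h1)
  have := CoordinateRing.smul_basis_eq_zero (W' := E.toAffine) (p := 0) (q := 1)
    (by rw [CoordinateRing.smul, CoordinateRing.smul, h]; simp)
  exact one_ne_zero this.2

theorem psi_two : psi 2 = 2 * yFun := by
  rw [psi_eq_psiAt, psiAt_two]

theorem psi_two_ne_zero : psi 2 ≠ 0 := by
  rw [psi_two]
  exact mul_ne_zero two_ne_zero yFun_ne_zero

theorem psi_eq (n : ℤ) : psi n = ofX (E.preΨ n) * if Even n then psi 2 else 1 := by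
  have h : psi n = toFunHom (E.Ψ n) := congrArg (algebraMap _ _) (CoordinateRing.mk_ψ E n)
  have h2 : psi 2 = toFunHom E.ψ₂ := by rw [psi, ← toFunHom_apply, ψ_two]
  rw [h, h2, WeierstrassCurve.Ψ, map_mul]
  split_ifs
  · rfl
  · rw [map_one]; rfl

theorem psi_sq (n : ℤ) : psi n ^ 2 = ofX (E.ΨSq n) := by
  have h : psi n = toFunHom (E.Ψ n) := congrArg (algebraMap _ _) (CoordinateRing.mk_ψ E n)
  rw [h]
  exact (map_pow _ _ 2).symm.trans (congrArg (algebraMap _ _) (CoordinateRing.mk_Ψ_sq E n))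

theorem ofX_Φ (n : ℤ) : ofX (E.Φ n) = xFun * psi n ^ 2 - psi (n + 1) * psi (n - 1) := by
  have h : ofX (E.Φ n) = toFunHom (E.φ n) :=
    (congrArg (algebraMap _ _) (CoordinateRing.mk_φ E n)).symm
  rw [h, WeierstrassCurve.φ]
  refine (map_sub toFunHom _ _).trans ?_
  rw [map_mul, map_pow, map_mul]
  rfl

theorem psi_ne_zero {n : ℤ} (hn : n ≠ 0) : psi n ≠ 0 := by
  rw [psi_eq]
  refine mul_ne_zero ?_ ?_
  · rw [← ofXHom_apply, Ne, map_eq_zero_iff _ ofXHom_injective]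
    exact E.preΨ_ne_zero (Int.cast_ne_zero.2 hn)
  · split_ifs
    · exact psi_two_ne_zero
    · exact one_ne_zero

theorem nonsingular_generic :
    (shortCurve aFun bFun).toAffine.Nonsingular xFun yFun :=
  nonsingular_shortCurve equation_generic (mul_ne_zero two_ne_zero yFun_ne_zero)

theorem isDivSeq_generic : IsDivSeq (.some xFun yFun nonsingular_generic) xFun yFun
    fun n : ℕ => psi n where
  __ := (by simpa only [psi_eq_psiAt] using isNormRec_psiAt aFun bFun xFun yFun :
    IsNormRec fun n : ℕ => psi n)
  isAt := ⟨nonsingular_generic, rfl⟩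
  two := psi_two
  three := by simpa only [psi_eq_psiAt, Nat.cast_ofNat] using psiAt_three aFun bFun xFun yFun
  four := by simpa only [psi_eq_psiAt, Nat.cast_ofNat] using psiAt_four aFun bFun xFun yFun
  ne_zero n := psi_ne_zero (by positivity)

end GenericPoint

/-! ### The invariant derivation of the generic curve -/

section InvariantDerivation

open WeierstrassCurve.Affine TrivSqZeroExt

/-- Polynomials in `x` and `y` at the point `(x + 2 y ε, y + (3 x² + A) ε)` of the generic curve
over the dual numbers of its function field. -/
def dualEval : Polynomial (Polynomial BaseRing) →+* DualNumber FunField :=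
  eval₂RingHom (eval₂RingHom ((inlHom FunField FunField).comp (ofXHom.comp C))
    (inl xFun + inr (2 * yFun))) (inl yFun + inr (3 * xFun ^ 2 + aFun))

theorem fst_dualEval (p : Polynomial (Polynomial BaseRing)) : (dualEval p).fst = toFun p := by
  have h : (fstHom FunField FunField FunField).toRingHom.comp dualEval = toFunHom := by
    apply Polynomial.ringHom_ext
    · intro q
      have h : ((fstHom FunField FunField FunField).toRingHom.comp dualEval).comp C = ofXHom := by
        apply Polynomial.ringHom_ext
        · intro r; simp [dualEval]
        · simp [dualEval]; rfl
      exact congrArg (· q) h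
    · simp [dualEval]; rfl
  exact congrArg (· p) h

theorem dualEval_C (p : Polynomial BaseRing) :
    dualEval (C p) = inl (ofX p) + inr (ofX (derivative p) * (2 * yFun)) := by
  ext
  · rw [fst_dualEval]
    simp [ofX]
  · simp only [← ofXHom_apply, snd_add, snd_inl, snd_inr, zero_add]
    induction p using Polynomial.induction_on' with
    | add p q hp hq =>
      rw [C_add, map_add, snd_add, hp, hq, derivative_add, map_add, add_mul]
    | monomial n r =>
      have h : ofXHom X = xFun := rfl
      rw [derivative_monomial]
      simp only [← C_mul_X_pow_eq_monomial, map_mul, map_pow, map_natCast, h]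
      simp [dualEval, snd_pow]
      ring

theorem toFun_polynomial : toFun E.toAffine.polynomial = 0 := by
  rw [toFun, CoordinateRing.mk, AdjoinRoot.mk_self, map_zero]

/-- The chosen point over the dual numbers lies on the generic curve. -/
theorem dualEval_polynomial : dualEval E.toAffine.polynomial = 0 := by
  ext
  · rw [fst_dualEval, toFun_polynomial, fst_zero]
  · have h : E.toAffine.polynomial = X ^ 2 -
        C (X ^ 3 + C (MvPolynomial.X 0) * X + C (MvPolynomial.X 1)) := by
      simp [WeierstrassCurve.Affine.polynomial, shortCurve]
    have hA : ofXHom (C (MvPolynomial.X 0)) = aFun := rfl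
    have hx : ofXHom X = xFun := rfl
    have h2 : ofXHom (C 2) = 2 := by rw [C_ofNat, map_ofNat]
    refine (congrArg (fun p => snd (dualEval p)) h).trans ?_
    refine (congrArg snd (map_sub dualEval _ _)).trans ?_
    rw [snd_sub, dualEval_C, ← ofXHom_apply, ← ofXHom_apply]
    simp [dualEval, hA, hx, h2, snd_pow]
    ring

/-- `dualEval` on the coordinate ring of the generic curve. -/
def dualCoord : E.toAffine.CoordinateRing →+* DualNumber FunField :=
  AdjoinRoot.lift (dualEval.comp C) (dualEval X) <| by
    have h := congrArg dualEval (eval₂_C_X (p := E.toAffine.polynomial))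
    rw [hom_eval₂] at h
    exact h.trans dualEval_polynomial

theorem dualCoord_mk (p : Polynomial (Polynomial BaseRing)) :
    dualCoord (CoordinateRing.mk E p) = dualEval p := by
  rw [dualCoord, CoordinateRing.mk, AdjoinRoot.lift_mk]
  conv_rhs => rw [← Polynomial.eval₂_C_X (p := p)]
  rw [hom_eval₂]

theorem fst_dualCoord (f : E.toAffine.CoordinateRing) :
    (dualCoord f).fst = algebraMap E.toAffine.CoordinateRing FunField f := by
  obtain ⟨p, rfl⟩ := AdjoinRoot.mk_surjective f
  exact (congrArg fst (dualCoord_mk p)).trans (fst_dualEval p)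

/-- A function `f` of the generic curve goes to `f + D f ε`, with `D` the invariant derivation. -/
def dualFun : FunField →+* DualNumber FunField :=
  IsLocalization.lift (M := nonZeroDivisors E.toAffine.CoordinateRing) (g := dualCoord) <| by
    rintro ⟨f, hf⟩
    rw [isUnit_iff_isUnit_fst, fst_dualCoord, isUnit_iff_ne_zero]
    exact IsFractionRing.to_map_ne_zero_of_mem_nonZeroDivisors hf

theorem dualFun_toFun (p : Polynomial (Polynomial BaseRing)) : dualFun (toFun p) = dualEval p := by
  rw [dualFun, toFun, IsLocalization.lift_eq, dualCoord_mk]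

theorem fst_dualFun (f : FunField) : (dualFun f).fst = f := by
  have h : (fstHom FunField FunField FunField).toRingHom.comp dualFun = RingHom.id FunField := by
    apply IsLocalization.ringHom_ext (nonZeroDivisors E.toAffine.CoordinateRing)
    refine RingHom.ext fun f => ?_
    simpa [dualFun] using fst_dualCoord f
  exact congrArg (· f) h

/-- The derivation `D` with `φ f = f + D f ε`. -/
def derivationOfDual {F : Type*} [Field F] (φ : F →+* DualNumber F) (h : ∀ f, (φ f).fst = f) :
    Derivation ℤ F F where
  toFun f := (φ f).snd
  map_add' f g := by simp
  map_smul' n f := by simp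
  map_one_eq_zero' := by simp
  leibniz' f g := by simp [h, mul_comm]

/-- The derivation dual to the invariant differential `dx / 2y` of the generic curve: it kills
`ℤ[A, B]` and maps `x` to `2 y`. -/
def invDeriv := derivationOfDual dualFun fst_dualFun

theorem invDeriv_ofX (p : Polynomial BaseRing) :
    invDeriv (ofX p) = ofX (derivative p) * (2 * yFun) := by
  have h : dualFun (ofX p) = _ := (dualFun_toFun (C p)).trans (dualEval_C p)
  refine (congrArg snd h).trans ?_
  simp

theorem invDeriv_aFun : invDeriv aFun = 0 := by
  rw [aFun, invDeriv_ofX, derivative_C, ← ofXHom_apply, map_zero, zero_mul]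

theorem invDeriv_bFun : invDeriv bFun = 0 := by
  rw [bFun, invDeriv_ofX, derivative_C, ← ofXHom_apply, map_zero, zero_mul]

theorem invDeriv_xFun : invDeriv xFun = 2 * yFun := by
  rw [xFun, invDeriv_ofX, derivative_X, ← ofXHom_apply, map_one, one_mul]

/-- The invariance of the differential, `d(x ∘ [n]) / 2 (y ∘ [n]) = n dx / 2y`, in terms of
division polynomials. -/
theorem wronskian_Φ_ΨSq (n : ℕ) (hn : 1 ≤ n) :
    derivative (E.Φ n) * E.ΨSq n - E.Φ n * derivative (E.ΨSq n) = (n : ℤ) * E.preΨ (2 * n) := by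
  classical
  obtain ⟨k, rfl⟩ := Nat.exists_eq_add_of_le' hn
  have h0 := psi_ne_zero (n := k + 1) (by positivity)
  have hX : mulX xFun (fun n : ℕ => psi n) k = ofX (E.Φ ↑(k + 1)) / ofX (E.ΨSq ↑(k + 1)) := by
    rw [ofX_Φ, ← psi_sq, mulX]
    push_cast
    rw [show (k : ℤ) + 1 + 1 = k + 2 by ring, show (k : ℤ) + 1 - 1 = k by ring]
    field_simp
  have h := isDivSeq_generic.deriv_num_mul_sub invDeriv invDeriv_aFun invDeriv_bFun invDeriv_xFun
    (psi_sq _) hX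
  rw [invDeriv_ofX, invDeriv_ofX, Nat.cast_mul, Nat.cast_two, psi_eq (2 * _),
    if_pos (even_two_mul _), psi_two] at h
  apply ofXHom_injective
  apply mul_right_cancel₀ (mul_ne_zero two_ne_zero yFun_ne_zero)
  refine (congrArg (· * (2 * yFun)) (map_sub ofXHom _ _)).trans ?_
  simp only [map_mul, ofXHom_apply, map_intCast]
  push_cast at h ⊢
  linear_combination h

end InvariantDerivation

/-! ### The Jacobian determinant -/

section Jacobian

variable {R : Type*} [CommRing R]

theorem pderiv_homogenize (p : Polynomial R) (N : ℕ) :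
    MvPolynomial.pderiv 0 (p.homogenize (N + 1)) = (derivative p).homogenize N := by
  induction p using Polynomial.induction_on' with
  | add p q hp hq => rw [homogenize_add, map_add, hp, hq, derivative_add, homogenize_add]
  | monomial m r =>
    rw [derivative_monomial]
    rcases m with _ | m
    · simp [← C_mul_X_pow_eq_monomial]
    rcases lt_or_ge N m with h | h
    · rw [homogenize_monomial_of_lt (by omega), homogenize_monomial_of_lt (by omega), map_zero]
    · rw [← C_mul_X_pow_eq_monomial, ← C_mul_X_pow_eq_monomial, homogenize_C_mul,
        homogenize_C_mul, homogenize_X_pow (by omega), homogenize_X_pow (by omega)]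
      simp
      ring

theorem X_one_mul_homogenize {p : Polynomial R} {N : ℕ} (h : p.natDegree ≤ N) :
    MvPolynomial.X 1 * p.homogenize N = p.homogenize (N + 1) := by
  have := homogenize_mul p 1 h (n := 1) (by simp)
  rw [mul_one, homogenize_one, pow_one] at this
  rw [this, mul_comm]

/-- By Euler's identity the Jacobian determinant of a pair of binary forms is the homogenised
Wronskian of the dehomogenised pair. -/
theorem X_one_mul_det_jacobianMatrix {f g : Polynomial R} {M : ℕ} (hf : f.natDegree ≤ M + 1)
    (hg : g.natDegree ≤ M + 1) :
    MvPolynomial.X 1 *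
        (jacobianMatrix ![f.homogenize (M + 1), g.homogenize (M + 1)]).det =
      ((M + 1 : ℕ) : MvPolynomial (Fin 2) R) *
        (derivative f * g - f * derivative g).homogenize (M + (M + 1)) := by
  have hf' : (derivative f).natDegree ≤ M := (natDegree_derivative_le f).trans (by omega)
  have hg' : (derivative g).natDegree ≤ M := (natDegree_derivative_le g).trans (by omega)
  have ef := (isHomogeneous_homogenize (n := M + 1) f).sum_X_mul_pderiv
  have eg := (isHomogeneous_homogenize (n := M + 1) g).sum_X_mul_pderiv
  rw [Fin.sum_univ_two, pderiv_homogenize, nsmul_eq_mul] at ef eg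
  have e1 := homogenize_mul (derivative f) g hf' hg
  have e2 := homogenize_mul (derivative g) f hg' hf
  rw [homogenize_sub, e1, mul_comm f, e2, Matrix.det_fin_two]
  simp only [jacobianMatrix, Matrix.of_apply, Matrix.cons_val_zero, Matrix.cons_val_one,
    pderiv_homogenize]
  linear_combination (derivative f).homogenize M * eg - (derivative g).homogenize M * ef

theorem natDegree_preΨ_two_mul (n : ℕ) : (E.preΨ (2 * n)).natDegree ≤ 2 * (n ^ 2 - 1) := by
  refine (E.natDegree_preΨ_le _).trans ?_
  rw [if_pos (even_two_mul _), Int.natAbs_mul, Int.natAbs_natCast, mul_pow]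
  simp only [Int.reduceAbs, Nat.reducePow]
  omega

theorem det_J {n : ℕ} (hn : 1 ≤ n) : (J n).det =
    (n : MvPolynomial (Fin 2) BaseRing) ^ 3 * (E.preΨ (2 * n)).homogenize (2 * (n ^ 2 - 1)) := by
  obtain ⟨M, hM⟩ : ∃ M, n ^ 2 = M + 1 := Nat.exists_eq_add_of_le' (Nat.one_le_pow _ _ hn)
  have hd := natDegree_preΨ_two_mul n
  have hΦ := E.natDegree_Φ_le n
  have hΨ := (E.natDegree_ΨSq_le n).trans (Nat.sub_le _ _)
  have h := X_one_mul_det_jacobianMatrix (M := M) (hM ▸ hΦ) (hM ▸ hΨ)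
  rw [← hM] at h
  apply mul_left_cancel₀ (MvPolynomial.X_ne_zero (R := BaseRing) (1 : Fin 2))
  rw [mul_left_comm, X_one_mul_homogenize hd]
  refine h.trans ?_
  rw [wronskian_Φ_ΨSq n hn, show M + n ^ 2 = 2 * (n ^ 2 - 1) + 1 by omega]
  have hc : ((n : ℤ) : Polynomial BaseRing) = C (n : BaseRing) := by simp
  rw [hc, homogenize_C_mul]
  push_cast
  rw [map_natCast]
  ring

/-- `p.homogenize N` is `Z^N p(X/Z)`. -/
theorem eval₂_homogenize {K : Type*} [CommRing K] (f : R →+* K) (x t : K) {p : Polynomial R} {N : ℕ}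
    (h : p.natDegree ≤ N) :
    MvPolynomial.eval₂ f ![x * t, t] (p.homogenize N) = t ^ N * p.eval₂ f x := by
  apply Polynomial.induction_with_natDegree_le
    (fun p ↦ MvPolynomial.eval₂ f ![x * t, t] (p.homogenize N) = t ^ N * p.eval₂ f x) (N := N)
  · simp
  · intro m r _ hm
    rw [homogenize_C_mul, homogenize_X_pow hm]
    obtain ⟨k, rfl⟩ := Nat.exists_eq_add_of_le hm
    simp [pow_add, mul_pow]
    ring
  · intro p q _ _ hp hq
    simp [hp, hq, mul_add]
  · exact h

end Jacobian

/-! ### The polynomial `ψ₂ₙ / ψ₂` -/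

section Doubling

open WeierstrassCurve.Affine

theorem normEDS_scale {K : Type*} [Field K] {l : K} (hl : l ≠ 0) (b c d : K) (n : ℕ) :
    normEDS (l ^ 3 * b) (l ^ 8 * c) (l ^ 12 * d) n * l = l ^ n ^ 2 * normEDS b c d n := by
  -- the exponent of `l` in the auxiliary sequence, which lacks the factor `b` of the even terms
  have h : preNormEDS' ((l ^ 3 * b) ^ 4) (l ^ 8 * c) (l ^ 12 * d) n =
      l ^ n ^ 2 * preNormEDS' (b ^ 4) c d n / if Even n then l ^ 4 else l := by
    induction n using normEDSRec with
    | zero => simp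
    | one => simp [hl]
    | two => simp [hl]
    | three =>
      rw [preNormEDS'_three, preNormEDS'_three, if_neg (by decide)]
      field_simp
      ring
    | four =>
      rw [preNormEDS'_four, preNormEDS'_four, if_pos (by decide)]
      field_simp
      ring
    | even m e1 e2 e3 e4 e5 =>
      rw [preNormEDS'_even, preNormEDS'_even, e1, e2, e3, e4, e5, if_pos (even_two_mul _)]
      simp only [Nat.even_add_one]
      by_cases h : Even m <;> simp only [h, if_true, if_false, not_true, not_false_iff] <;>
        field_simp <;> ring
    | odd m e1 e2 e3 e4 =>
      rw [preNormEDS'_odd, preNormEDS'_odd, e1, e2, e3, e4, if_neg (m + 2).not_even_two_mul_add_one]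
      simp only [Nat.even_add_one]
      by_cases h : Even m <;> simp only [h, if_true, if_false, not_true, not_false_iff] <;>
        field_simp <;> ring
  rw [normEDS_ofNat, normEDS_ofNat, h]
  split_ifs <;> field_simp

/-- Division polynomials are weighted homogeneous. -/
theorem psiAt_scale {K : Type*} [Field K] {l : K} (hl : l ≠ 0) (a b x y : K) {n : ℕ} (hn : 1 ≤ n) :
    psiAt (l ^ 4 * a) (l ^ 6 * b) (l ^ 2 * x) (l ^ 3 * y) n =
      l ^ (n ^ 2 - 1) * psiAt a b x y n := by
  apply mul_right_cancel₀ hl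
  rw [mul_right_comm, ← pow_succ, Nat.sub_add_cancel (Nat.one_le_pow _ _ hn), psiAt_eq_normEDS,
    psiAt_eq_normEDS, ← normEDS_scale hl]
  congr 2 <;> ring

/-- The value at `2 Q`, for `Q = (x, y)`, of the `n`-th division polynomial, multiplied by
`(2 y) ^ (n ^ 2 - 1)`; it is polynomial in `a`, `b`, `x`, `y`. -/
def psiDouble {K : Type*} [CommRing K] (a b x y : K) (n : ℤ) : K :=
  psiAt ((2 * y) ^ 4 * a) ((2 * y) ^ 6 * b)
    ((2 * y) ^ 2 * x - (3 * x ^ 4 + 6 * a * x ^ 2 + 12 * b * x - a ^ 2))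
    (x ^ 6 + 5 * a * x ^ 4 + 20 * b * x ^ 3 - 5 * a ^ 2 * x ^ 2 - 4 * a * b * x - 8 * b ^ 2 - a ^ 3)
    n

theorem map_psiAt {K L : Type*} [CommRing K] [CommRing L] (f : K →+* L) (a b x y : K) (n : ℤ) :
    f (psiAt a b x y n) = psiAt (f a) (f b) (f x) (f y) n := by
  simp [psiAt_eq_normEDS, map_ofNat f]

theorem map_psiDouble {K L : Type*} [CommRing K] [CommRing L] (f : K →+* L) (a b x y : K) (n : ℤ) :
    f (psiDouble a b x y n) = psiDouble (f a) (f b) (f x) (f y) n := by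
  simp [psiDouble, map_psiAt, map_ofNat f]

theorem psiAt_six {F : Type*} [Field F] {a b x y : F} (h : y ^ 2 = x ^ 3 + a * x + b)
    (hy : 2 * y ≠ 0) : psiAt a b x y 6 = 2 * y * psiDouble a b x y 3 := by
  have hw := isNormRec_psiAt a b x y
  have e5 := hw.odd 1
  have e6 := hw.even 1
  have hb : b = y ^ 2 - x ^ 3 - a * x := by linear_combination -h
  simp only [Nat.reduceMul, Nat.reduceAdd, Nat.cast_ofNat, hw.one, psiAt_two, psiAt_three,
    psiAt_four, psiDouble] at e5 e6 ⊢
  apply mul_right_cancel₀ hy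
  rw [e6, e5, hb]
  ring

theorem psiAt_eight {F : Type*} [Field F] {a b x y : F} (h : y ^ 2 = x ^ 3 + a * x + b)
    (hy : 2 * y ≠ 0) : psiAt a b x y 8 = 2 * y * psiDouble a b x y 4 := by
  have hw := isNormRec_psiAt a b x y
  have e5 := hw.odd 1
  have e6 := psiAt_six h hy
  have e8 := hw.even 2
  have hb : b = y ^ 2 - x ^ 3 - a * x := by linear_combination -h
  simp only [Nat.reduceMul, Nat.reduceAdd, Nat.cast_ofNat, hw.one, psiAt_two, psiAt_three,
    psiAt_four, psiDouble] at e5 e6 e8 ⊢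
  apply mul_right_cancel₀ hy
  rw [e8, e6, e5, hb]
  ring

/-- Both `ψ₂ₙ / ψ₂` and `psiDouble` satisfy the recursion of a normalised elliptic divisibility
sequence, and their terms agree for `n = 2, 3, 4`. -/
theorem psi_two_mul (n : ℕ) :
    psi (2 * n) = psi 2 * psiDouble aFun bFun xFun yFun n := by
  classical
  have hw := isDivSeq_generic
  have h2 := psi_two_ne_zero
  have hy : 2 * yFun ≠ 0 := mul_ne_zero two_ne_zero yFun_ne_zero
  suffices h : (fun n : ℕ => psi ↑(2 * n) / psi 2) =
      fun n : ℕ => psiDouble aFun bFun xFun yFun n by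
    have := congrFun h n
    rw [← this, mul_div_cancel₀ _ h2]
    push_cast
    rfl
  apply IsNormRec.ext
  · constructor
    · simpa [h2] using hw.zero
    · simp [h2]
    · intro m
      have := hw.even_double m
      simp only [Nat.cast_ofNat] at this ⊢
      field_simp
      linear_combination this
    · intro m
      have := hw.odd_double m
      simp only [Nat.cast_ofNat] at this ⊢
      field_simp
      linear_combination this
  · exact isNormRec_psiAt _ _ _ _
  · rw [div_eq_iff h2]
    simp only [Nat.reduceMul, Nat.cast_ofNat, psiDouble, psi_eq_psiAt, psiAt_two, psiAt_four]
    ring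
  · rw [div_eq_iff h2]
    simp only [Nat.reduceMul, Nat.cast_ofNat, psi_eq_psiAt, psiAt_two]
    exact (psiAt_six equation_generic hy).trans (mul_comm _ _)
  · rw [div_eq_iff h2]
    simp only [Nat.reduceMul, Nat.cast_ofNat, psi_eq_psiAt, psiAt_two]
    exact (psiAt_eight equation_generic hy).trans (mul_comm _ _)
  · have h4 : psi 4 = psi 2 * psiDouble aFun bFun xFun yFun 2 := by
      simp only [psiDouble, psi_eq_psiAt, psiAt_two, psiAt_four]
      ring
    exact right_ne_zero_of_mul (h4 ▸ psi_ne_zero (by decide))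

end Doubling

/-! ### Specialisation of the parameters -/

section Specialisation

open WeierstrassCurve.Affine

variable {K : Type*} [Field K] {a b x y : K}

/-- The specialisation `(A, B) ↦ (a, b)`. -/
def specBase (a b : K) : BaseRing →+* K :=
  MvPolynomial.eval₂Hom (Int.castRingHom K) ![a, b]

/-- The specialisation `(A, B, x, y) ↦ (a, b, x, y)` of polynomials in `x` and `y`. -/
def spec (a b x y : K) : Polynomial (Polynomial BaseRing) →+* K :=
  (evalEvalRingHom x y).comp (mapRingHom (mapRingHom (specBase a b)))

theorem spec_C (p : Polynomial BaseRing) : spec a b x y (C p) = p.eval₂ (specBase a b) x := by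
  simp [spec, eval_map]

theorem map_specBase : E.map (specBase a b) = shortCurve a b := by
  ext <;> simp [shortCurve, WeierstrassCurve.map, specBase]

theorem spec_ψ (n : ℤ) : spec a b x y (E.ψ n) = psiAt a b x y n := by
  rw [psiAt, ← map_specBase, WeierstrassCurve.map_ψ]
  rfl

/-- Polynomials with the same values on the generic curve have the same values on every cubic. -/
theorem spec_eq_of_toFun_eq (h : y ^ 2 = x ^ 3 + a * x + b)
    {p q : Polynomial (Polynomial BaseRing)} (hpq : toFun p = toFun q) :
    spec a b x y p = spec a b x y q := by
  have h1 : CoordinateRing.mk E p = CoordinateRing.mk E q :=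
    IsFractionRing.injective E.toAffine.CoordinateRing FunField hpq
  obtain ⟨r, hr⟩ := AdjoinRoot.mk_eq_mk.1 h1
  have h2 : spec a b x y E.toAffine.polynomial = 0 := by
    have := equation_shortCurve.2 h
    rw [WeierstrassCurve.Affine.Equation, ← map_specBase] at this
    rw [← this]
    exact (congrArg (evalEval x y) (WeierstrassCurve.Affine.map_polynomial ..)).symm
  rw [← sub_eq_zero, ← map_sub]
  refine (congrArg _ hr).trans ?_
  rw [map_mul, h2, zero_mul]

/-- The polynomial in `x` and `y` which becomes `ψ₂ₙ / ψ₂` modulo the equation of the curve. -/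
def psiDoublePoly (n : ℕ) : Polynomial (Polynomial BaseRing) :=
  psiDouble (C (C (MvPolynomial.X 0))) (C (C (MvPolynomial.X 1))) (C X) X n

theorem map_psiDoublePoly {L : Type*} [CommRing L] (f : Polynomial (Polynomial BaseRing) →+* L)
    (n : ℕ) : f (psiDoublePoly n) =
      psiDouble (f (C (C (MvPolynomial.X 0)))) (f (C (C (MvPolynomial.X 1)))) (f (C X)) (f X) n :=
  map_psiDouble (K := Polynomial (Polynomial BaseRing)) f _ _ _ _ _

theorem eval₂_preΨ_two_mul (h : y ^ 2 = x ^ 3 + a * x + b) (hy : 2 * y ≠ 0) (n : ℕ) :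
    (E.preΨ (2 * n)).eval₂ (specBase a b) x = psiDouble a b x y n := by
  have h1 : toFun (E.ψ 2 * C (E.preΨ (2 * n))) = toFun (E.ψ 2 * psiDoublePoly n) := by
    rw [← toFunHom_apply, ← toFunHom_apply, map_mul, map_mul, map_psiDoublePoly]
    refine Eq.trans ?_ (psi_two_mul n)
    rw [psi_eq (2 * n), if_pos (even_two_mul _), mul_comm]
    rfl
  have h2 := spec_eq_of_toFun_eq h h1
  rw [map_mul, map_mul, spec_C, spec_ψ, psiAt_two, map_psiDoublePoly] at h2
  rw [mul_left_cancel₀ hy h2]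
  congr 1 <;> simp [spec, specBase]

theorem detJAt_eq (h : y ^ 2 = x ^ 3 + a * x + b) (hy : 2 * y ≠ 0) (t : K) {n : ℕ} (hn : 1 ≤ n) :
    detJAt a b (x * t) t n = (n : K) ^ 3 * (t ^ (2 * (n ^ 2 - 1)) * psiDouble a b x y n) := by
  rw [detJAt, det_J hn, MvPolynomial.eval₂_mul, MvPolynomial.eval₂_pow,
    MvPolynomial.eval₂_natCast, eval₂_homogenize _ _ _ (natDegree_preΨ_two_mul n)]
  exact congrArg _ (congrArg _ (eval₂_preΨ_two_mul h hy n))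

/-- `psiDouble` is the sequence of division polynomials at the image of `2 Q` on the curve with
coefficients `(2 y)⁴ a` and `(2 y)⁶ b`. -/
theorem psiDouble_eq [DecidableEq K] {P : (shortCurve a b).toAffine.Point} (hP : IsAt P x y)
    (hy : 2 * y ≠ 0) {u v : K} (h : IsAt (P + P) u v) {n : ℕ} (hn : 1 ≤ n) :
    psiDouble a b x y n = (2 * y) ^ (n ^ 2 - 1) * psiAt a b u v n := by
  obtain ⟨rfl, rfl⟩ := h.unique (hP.double hy)
  -- `b` is eliminated, so that only the rational expressions in `a`, `x`, `y` are compared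
  have hb : b = y ^ 2 - x ^ 3 - a * x := by linear_combination -hP.equation
  rw [← psiAt_scale hy _ _ _ _ hn, psiDouble]
  have h2 : (2 : K) ≠ 0 := left_ne_zero_of_mul hy
  have hy' : y ≠ 0 := right_ne_zero_of_mul hy
  congr 1
  · rw [hb]; field_simp; ring
  · rw [hb]; field_simp; ring

theorem detJAt_eq_psiAt [DecidableEq K] {P : (shortCurve a b).toAffine.Point} (hP : IsAt P x y)
    (hy : 2 * y ≠ 0) {u v : K} (h : IsAt (P + P) u v) (t : K) {n : ℕ} (hn : 1 ≤ n) :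
    detJAt a b (x * t) t n = (n : K) ^ 3 * (2 * y * t ^ 2) ^ (n ^ 2 - 1) * psiAt a b u v n := by
  rw [detJAt_eq hP.equation hy t hn, psiDouble_eq hP hy h hn, mul_pow (2 * y), ← pow_mul]
  ring

/-- If `P + P` is affine, then the ordinate of `P` is nonzero. -/
theorem two_mul_ne_zero_of_add_self [DecidableEq K] {P : (shortCurve a b).toAffine.Point}
    (hP : IsAt P x y) (h : P + P ≠ 0) : 2 * y ≠ 0 := by
  obtain ⟨hP, rfl⟩ := hP
  intro hy
  apply h
  apply WeierstrassCurve.Affine.Point.add_self_of_Y_eq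
  simp only [WeierstrassCurve.Affine.negY, shortCurve]
  linear_combination hy

end Specialisation

/-! ### Halving points -/

section Halving

variable {K : Type*} [Field K] [CharZero K] [IsAlgClosed K] {a b x y : K}

/-- The slopes `l` of the tangents that pass through `-P`, for `P = (x, y)`, are the roots of a
quartic; unless `P` is singular, one of them gives a tangent at a point with nonzero ordinate. -/
theorem exists_tangent_slope (hs : ¬(y = 0 ∧ 3 * x ^ 2 + a = 0)) :
    ∃ l : K, l ^ 4 - 6 * x * l ^ 2 - 8 * y * l - 3 * x ^ 2 - 4 * a = 0 ∧
      l ^ 3 - 3 * x * l - 2 * y ≠ 0 := by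
  obtain ⟨l, hl⟩ : ∃ l : K, l ^ 4 - 6 * x * l ^ 2 - 8 * y * l - 3 * x ^ 2 - 4 * a = 0 := by
    have hd : (X ^ 4 - C (6 * x) * X ^ 2 - C (8 * y) * X - C (3 * x ^ 2 + 4 * a)).degree = 4 := by
      compute_degree!
    obtain ⟨l, hl⟩ := IsAlgClosed.exists_root
      (X ^ 4 - C (6 * x) * X ^ 2 - C (8 * y) * X - C (3 * x ^ 2 + 4 * a))
      (by rw [hd]; exact four_ne_zero)
    refine ⟨l, ?_⟩
    simp only [IsRoot.def, eval_sub, eval_mul, eval_pow, eval_X, eval_C] at hl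
    linear_combination hl
  by_cases h : l ^ 3 - 3 * x * l - 2 * y = 0
  swap
  · exact ⟨l, hl, h⟩
  -- now `l` is a double root, and the other factor is `m ^ 2 + 2 * l * m + 3 * l ^ 2 - 6 * x`
  have hy : y = (l ^ 3 - 3 * x * l) / 2 := by linear_combination -h / 2
  have ha : a = -3 * (l ^ 2 - x) ^ 2 / 4 := by
    rw [hy] at hl
    linear_combination -hl / 4
  obtain ⟨r, hr⟩ := IsAlgClosed.exists_pow_nat_eq (6 * x - 2 * l ^ 2) (n := 2) (by decide)
  by_cases h' : (r - l) ^ 3 - 3 * x * (r - l) - 2 * y = 0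
  swap
  · refine ⟨r - l, ?_, h'⟩
    rw [hy, ha]
    linear_combination (r - 2 * l) ^ 2 * hr
  have hx : x = (r ^ 2 + 2 * l ^ 2) / 6 := by linear_combination -hr / 6
  have h3 : r * (r - 2 * l) ^ 2 = 0 := by
    rw [hy, hx] at h'
    linear_combination 2 * h'
  rcases mul_eq_zero.1 h3 with h0 | h0
  · -- the second root is `-l`, and `P` is the singular point
    refine absurd ⟨?_, ?_⟩ hs
    · rw [hy, hx, h0]; ring
    · rw [ha, hx, h0]; ring
  · -- the second root is again `l`, the curve is `y ^ 2 = x ^ 3`, and `-3 * l` is the fourth root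
    have hr' : r = 2 * l := sub_eq_zero.1 (pow_eq_zero_iff two_ne_zero |>.1 h0)
    have hx' : x = l ^ 2 := by rw [hx, hr']; ring
    refine ⟨-3 * l, ?_, ?_⟩
    · rw [hy, ha, hx']; ring
    · intro h4
      have hl0 : l = 0 := by
        have : l ^ 3 = 0 := by
          rw [hy, hx'] at h4
          linear_combination -h4 / 16
        exact pow_eq_zero_iff three_ne_zero |>.1 this
      exact hs ⟨by rw [hy, hl0]; ring, by rw [ha, hx', hl0]; ring⟩

/-- Nonsingular points over an algebraically closed field can be halved. -/
theorem exists_half [DecidableEq K] {P : (shortCurve a b).toAffine.Point} (hP : IsAt P x y) :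
    ∃ (x₁ y₁ : K) (Q : (shortCurve a b).toAffine.Point), IsAt Q x₁ y₁ ∧ 2 * y₁ ≠ 0 ∧
      IsAt (Q + Q) x y := by
  have hs : ¬(y = 0 ∧ 3 * x ^ 2 + a = 0) := by
    rintro ⟨h1, h2⟩
    have := hP.1
    rw [WeierstrassCurve.Affine.nonsingular_iff] at this
    simp only [shortCurve] at this
    rcases this.2 with h | h
    · exact h (by linear_combination -h2)
    · exact h (by rw [h1]; ring)
  obtain ⟨l, hl, hl'⟩ := exists_tangent_slope hs
  have ha : a = (l ^ 4 - 6 * x * l ^ 2 - 8 * y * l - 3 * x ^ 2) / 4 := by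
    linear_combination -hl / 4
  have hb : b = y ^ 2 - x ^ 3 - a * x := by linear_combination -hP.equation
  have he : (shortCurve a b).toAffine.Equation ((l ^ 2 - x) / 2)
      ((l ^ 3 - 3 * x * l - 2 * y) / 2) := by
    rw [equation_shortCurve, hb, ha]
    ring
  have h0 : 2 * ((l ^ 3 - 3 * x * l - 2 * y) / 2) ≠ 0 := by
    rwa [mul_div_cancel₀ _ two_ne_zero]
  have hQ : (shortCurve a b).toAffine.Nonsingular ((l ^ 2 - x) / 2)
      ((l ^ 3 - 3 * x * l - 2 * y) / 2) := by
    exact nonsingular_shortCurve (equation_shortCurve.1 he) h0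
  have hQ' : IsAt (.some _ _ hQ) _ _ := ⟨hQ, rfl⟩
  refine ⟨_, _, _, hQ', h0, ?_⟩
  have hsl : (3 * ((l ^ 2 - x) / 2) ^ 2 + a) / (2 * ((l ^ 3 - 3 * x * l - 2 * y) / 2)) = l := by
    rw [div_eq_iff h0, ha]
    ring
  convert hQ'.double h0 using 1
  · rw [hsl]; ring
  · rw [hsl]; ring

/-- The scaling `t` is chosen such that `2 y₁ t² = 1`. -/
theorem exists_detJAt_eq [DecidableEq K] {P : (shortCurve a b).toAffine.Point} (hP : IsAt P x y) :
    ∃ (x₁ y₁ t : K) (Q : (shortCurve a b).toAffine.Point), IsAt Q x₁ y₁ ∧ Q + Q = P ∧ t ≠ 0 ∧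
      ∀ n : ℕ, 1 ≤ n → detJAt a b (x₁ * t) t n = (n : K) ^ 3 * psiAt a b x y n := by
  obtain ⟨x₁, y₁, Q, hQ, h0, h⟩ := exists_half hP
  obtain ⟨t, ht⟩ := IsAlgClosed.exists_pow_nat_eq (2 * y₁)⁻¹ (n := 2) (by decide)
  refine ⟨x₁, y₁, t, Q, hQ, ?_, ?_, ?_⟩
  · obtain ⟨_, e⟩ := h
    obtain ⟨_, e'⟩ := hP
    rw [e, e']
  · rintro rfl
    rw [zero_pow two_ne_zero] at ht
    exact inv_ne_zero h0 ht.symm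
  · intro n hn
    rw [detJAt_eq_psiAt hQ h0 h t hn, ht, mul_inv_cancel₀ h0, one_pow, mul_one]

end Halving

/-! ### Elliptic sequences as values of division polynomials -/

section EllipticSequences

theorem isNormRec_of_isEllipticSequence {K : Type*} [Field K] {h : ℤ → K}
    (hh : IsEllipticSequence h) (h1 : h 1 = 1) : IsNormRec fun n : ℕ => h n where
  zero := by
    have := hh 0 0 0
    simp only [IsEllipticNet.rel, add_zero, sub_zero] at this
    have h4 : h 0 ^ 4 = 0 := by linear_combination this
    simpa using h4
  one := by simpa using h1
  even m := by
    have := hh (m + 2 + 1) (m + 2 - 1) 1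
    rw [IsEllipticNet.rel_even, h1] at this
    push_cast
    rw [show (m : ℤ) + 2 - 1 = m + 1 by ring, show (m : ℤ) + 2 - 2 = m by ring,
      show (m : ℤ) + 2 + 2 = m + 4 by ring, show (m : ℤ) + 2 + 1 = m + 3 by ring] at this
    linear_combination this
  odd m := by
    have := hh (m + 1 + 1) (m + 1) 1
    rw [IsEllipticNet.rel_odd, h1] at this
    push_cast
    rw [show (m : ℤ) + 1 - 1 = m by ring, show (m : ℤ) + 1 + 2 = m + 3 by ring,
      show (m : ℤ) + 1 + 1 = m + 2 by ring] at this
    linear_combination this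

/-- A normalised elliptic sequence with `h₂ h₃ ≠ 0` is the sequence of values of the division
polynomials at a point of a cubic. -/
theorem exists_psiAt_eq {K : Type*} [Field K] [CharZero K] {h : ℤ → K}
    (hh : IsEllipticSequence h) (h1 : h 1 = 1) (h2 : h 2 ≠ 0) (h3 : h 3 ≠ 0) :
    ∃ a b x y : K, (shortCurve a b).toAffine.Nonsingular x y ∧
      ∀ n : ℕ, h n = psiAt a b x y n := by
  -- `m = 3 * x ^ 2 + a` is found from `h 4`, and then `x` from `h 3`
  obtain ⟨m, hm⟩ : ∃ m, m = (h 4 + h 2 ^ 5) / (2 * h 2 * h 3) := ⟨_, rfl⟩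
  obtain ⟨x, hx⟩ : ∃ x, x = (h 3 + m ^ 2) / (3 * h 2 ^ 2) := ⟨_, rfl⟩
  have h3' : h 3 = 3 * x * h 2 ^ 2 - m ^ 2 := by rw [hx]; field_simp; ring
  have h4' : h 4 = 2 * m * h 2 * h 3 - h 2 ^ 5 := by rw [hm]; field_simp; ring
  refine ⟨m - 3 * x ^ 2, (h 2 / 2) ^ 2 - x ^ 3 - (m - 3 * x ^ 2) * x, x, h 2 / 2, ?_, ?_⟩
  · exact nonsingular_shortCurve (by ring) (by rwa [mul_div_cancel₀ _ two_ne_zero])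
  · intro n
    refine congrFun ((isNormRec_of_isEllipticSequence hh h1).ext (isNormRec_psiAt _ _ _ _)
      ?_ ?_ ?_ ?_) n
    · rw [Nat.cast_ofNat, psiAt_two]; ring
    · rw [Nat.cast_ofNat, psiAt_three, h3']; ring
    · rw [Nat.cast_ofNat, psiAt_four, h4', h3']; ring
    · rw [Nat.cast_ofNat, psiAt_two, mul_div_cancel₀ _ two_ne_zero]; exact h2

end EllipticSequences

end EllipticJacobian

end

open EllipticJacobian in
theorem mainTheorem3 :
    -- the formula for `det Jₙ(X, Z)`; `g` is the polynomial in `x` equal to `ψ₂ₙ / ψ₂`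
    (∀ n : ℕ, 1 ≤ n → ∃ g : Polynomial BaseRing,
      ofX g = psi (2 * n) / psi 2 ∧
      ofX g = 2 * (psi n * omega n / psi 2) ∧
      algebraMap (MvPolynomial (Fin 2) BaseRing) FieldXZ (J n).det =
        (n : FieldXZ) ^ 3 * varZ ^ (2 * (n ^ 2 - 1)) * atXdivZ g) ∧
    -- the sequence `ψₙ(P)` in the determinants, for a point `P = 2 Q`
    (∀ (K : Type u) [Field K] [CharZero K] [DecidableEq K] (a b x₁ y₁ x₂ y₂ : K)
      (hQ : (shortCurve a b).toAffine.Nonsingular x₁ y₁)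
      (hP : (shortCurve a b).toAffine.Nonsingular x₂ y₂),
      WeierstrassCurve.Affine.Point.some x₁ y₁ hQ + WeierstrassCurve.Affine.Point.some x₁ y₁ hQ =
        WeierstrassCurve.Affine.Point.some x₂ y₂ hP →
      ∀ (t : K) (n : ℕ), 1 ≤ n →
        detJAt a b (x₁ * t) t n =
          (n : K) ^ 3 * (2 * y₁ * t ^ 2) ^ (n ^ 2 - 1) * psiAt a b x₂ y₂ n) ∧
    -- over an algebraically closed field, every point `P` gives such a determinant sequence
    (∀ (K : Type u) [Field K] [CharZero K] [IsAlgClosed K] [DecidableEq K] (a b x y : K)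
      (hP : (shortCurve a b).toAffine.Nonsingular x y),
      ∃ (x₁ y₁ t : K) (hQ : (shortCurve a b).toAffine.Nonsingular x₁ y₁),
        WeierstrassCurve.Affine.Point.some x₁ y₁ hQ +
          WeierstrassCurve.Affine.Point.some x₁ y₁ hQ =
            WeierstrassCurve.Affine.Point.some x y hP ∧
        t ≠ 0 ∧
        ∀ n : ℕ, 1 ≤ n → detJAt a b (x₁ * t) t n = (n : K) ^ 3 * psiAt a b x y n) ∧
    -- and so does every normalised proper elliptic divisibility sequence
    (∀ (K : Type u) [Field K] [CharZero K] [IsAlgClosed K] (h : ℤ → K),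
      IsEllipticSequence h → h 1 = 1 → h 2 ≠ 0 → h 3 ≠ 0 →
      ∃ a b s t : K, t ≠ 0 ∧
        ∀ n : ℕ, 1 ≤ n → detJAt a b s t n = (n : K) ^ 3 * h n) := by
  refine ⟨?_, ?_, ?_, ?_⟩
  · intro n hn
    have h2 := psi_two_ne_zero
    refine ⟨E.preΨ (2 * n), ?_, ?_, ?_⟩
    · rw [psi_eq (2 * n), if_pos (even_two_mul _), mul_div_cancel_right₀ _ h2]
    · have hn0 := psi_ne_zero (n := n) (by positivity)
      have hy := yFun_ne_zero
      have e : psi (2 * n) * psi 2 = psi (n - 1) ^ 2 * psi n * psi (n + 2)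
          - psi (n - 2) * psi n * psi (n + 1) ^ 2 := by
        simp only [psi_eq_psiAt, psiAt_eq_normEDS]
        rw [normEDS_two, normEDS_even]
      rw [psi_eq (2 * n), if_pos (even_two_mul _), psi_two] at e
      rw [omega, psi_two]
      field_simp
      linear_combination e
    · have h := eval₂_homogenize ((algebraMap (MvPolynomial (Fin 2) BaseRing) FieldXZ).comp
        MvPolynomial.C) (varX / varZ) varZ (natDegree_preΨ_two_mul n)
      have hZ : varZ ≠ 0 := by
        rw [varZ, Ne, map_eq_zero_iff _ (IsFractionRing.injective _ _)]
        exact MvPolynomial.X_ne_zero _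
      have e : MvPolynomial.eval₂ ((algebraMap (MvPolynomial (Fin 2) BaseRing) FieldXZ).comp
          MvPolynomial.C) ![varX, varZ] = algebraMap _ FieldXZ := by
        funext p
        rw [← MvPolynomial.coe_eval₂Hom]
        refine DFunLike.congr_fun (f := MvPolynomial.eval₂Hom _ _)
          (MvPolynomial.ringHom_ext ?_ ?_) p
        · intro r
          rw [MvPolynomial.coe_eval₂Hom, MvPolynomial.eval₂_C]
          rfl
        · intro i
          rw [MvPolynomial.coe_eval₂Hom, MvPolynomial.eval₂_X]
          fin_cases i <;> rfl
      rw [div_mul_cancel₀ _ hZ, e] at h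
      rw [det_J hn, map_mul, map_pow, map_natCast, h, atXdivZ]
      ring
  · intro K _ _ _ a b x₁ y₁ x₂ y₂ hQ hP h t n hn
    have hQ' : IsAt (.some x₁ y₁ hQ) x₁ y₁ := ⟨hQ, rfl⟩
    refine detJAt_eq_psiAt hQ' (two_mul_ne_zero_of_add_self hQ' ?_) ⟨hP, h⟩ t hn
    rw [h]
    exact WeierstrassCurve.Affine.Point.some_ne_zero hP
  · intro K _ _ _ _ a b x y hP
    obtain ⟨x₁, y₁, t, Q, ⟨hQ, rfl⟩, h, ht, H⟩ := exists_detJAt_eq ⟨hP, rfl⟩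
    exact ⟨x₁, y₁, t, hQ, h, ht, H⟩
  · intro K _ _ _ h hh h1 h2 h3
    classical
    obtain ⟨a, b, x, y, hP, e⟩ := exists_psiAt_eq hh h1 h2 h3
    obtain ⟨x₁, y₁, t, Q, -, -, ht, H⟩ := exists_detJAt_eq ⟨hP, rfl⟩
    refine ⟨a, b, x₁ * t, t, ht, fun n hn => ?_⟩
    rw [H n hn, e]
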